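/- **Setting.** Let $q_1,q_2,q_3\in\mathbb C$ satisfy $q_1q_2q_3=1$ and be generic: $q_1^Lq_2^Mq_3^N=1$ with $L,M,N\in\mathbb Z$ only if $L=M=N$. Fix fourth roots $q_i^{1/4}$, from which all fractional powers below are formed, and let $0<|p|<1$. Put $(x;p)_\infty=\prod_{k\ge0}(1-p^kx)$, $\theta_p(x)=(x;p)_\infty(p/x;p)_\infty$, $\Theta(x;q,p)_k=\prod_{j=0}^{k-1}\theta_p(q^jx)$ for $k\ge 0$, and $\kappa_l=(q_1^l-1)(q_2^l-1)(q_3^l-1)$. For $i\in\{1,2,3\}$ let $\mathcal H^{(i)}$ be the Fock space of the Heisenberg algebra with generators $a_{\pm l},b_{\pm l}$ ($l\ge1$) whose only nonzero commutators are $$[a_l,a_{-l}]=\tfrac{l}{\kappa_l}(q_i^{l/2}-q_i^{-l/2})(1-p^l),\qquad [b_l,b_{-l}]=\tfrac{l}{\kappa_l}(q_i^{l/2}-q_i^{-l/2})\tfrac{1-p^l}{p^l}\qquad(l\ge1),$$ with basis the monomials in the negative modes applied to a vacuum killed by the positive modes. Put $$\varphi^{-(i)}(z)=\exp\Big(\sum_{l\ge1}\tfrac{p^l}{1-p^l}\tfrac{\kappa_l}{l}q_i^{l/4}b_{-l}z^{-l}\Big)\exp\Big(-\sum_{l\ge1}\tfrac{1}{1-p^l}\tfrac{\kappa_l}{l}q_i^{-l/4}a_{-l}z^{l}\Big),$$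 $$\begin{aligned}\eta^{(i)}(z)={}&\exp\Big(\sum_{l\ge1}\tfrac{p^l}{1-p^l}\tfrac{\kappa_l}{l}\tfrac{q_i^{l/4}}{q_i^{l/2}-q_i^{-l/2}}b_{-l}z^{-l}\Big)\exp\Big(\sum_{l\ge1}\tfrac{1}{1-p^l}\tfrac{\kappa_l}{l}\tfrac{q_i^{-l/4}}{q_i^{l/2}-q_i^{-l/2}}a_{-l}z^{l}\Big)\\&\times\exp\Big(\sum_{l\ge1}\tfrac{p^l}{1-p^l}\tfrac{\kappa_l}{l}\tfrac{q_i^{-l/4}}{q_i^{-l}-1}b_{l}z^{l}\Big)\exp\Big(-\sum_{l\ge1}\tfrac{1}{1-p^l}\tfrac{\kappa_l}{l}\tfrac{q_i^{l/4}}{q_i^{l}-1}a_{l}z^{-l}\Big).\end{aligned}$$ In the horizontal Fock representation $\rho^{(i)}_{H,v}$ of the elliptic toroidal $\mathfrak{gl}_1$ algebra, $$E(z;p)\mapsto v\,\frac{(p;p)_\infty}{\prod_{j\neq i}\theta_p(q_j)}\,\eta^{(i)}(z),\qquad K^-(z;p)\mapsto\varphi^{-(i)}(z),\qquad C\mapsto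 q_i^{1/2}.$$ For $\vec c=(c_1,\dots,c_n)\in\{1,2,3\}^n$ and $\vec v=(v_1,\dots,v_n)\in\mathbb C^n$ let $\rho^{\vec c}_{H,\vec v}=(\rho^{(c_1)}_{H,v_1}\otimes\cdots\otimes\rho^{(c_n)}_{H,v_n})\circ\Delta^{(n-1)}$ be the tensor product representation, where $\Delta E(z)=E(z)\otimes1+K^-(C_1z)\otimes E(C_1z)$, $\Delta K^-(z)=K^-(C_2^{-1}z)\otimes K^-(z)$, $C_1=C\otimes1$, $C_2=1\otimes C$. **Elliptic Miura transformation.** For $\vec u\in\mathbb C^n$ put $$\Lambda_j(z)=u_j\,\varphi^{-(c_1)}(q_{c_1}^{1/2}z)\otimes\cdots\otimes\varphi^{-(c_{j-1})}(q_{c_1}^{1/2}\cdots q_{c_{j-1}}^{1/2}z)\otimes\eta^{(c_j)}(q_{c_1}^{1/2}\cdots q_{c_{j-1}}^{1/2}z)\otimes1\otimes\cdots\otimes1 ,$$ $$R_j(z)=\sum_{k\ge0}(-1)^kq_3^{k^2/2}q_{c_j}^{-k/2}\frac{\Theta(q_3^{1-k}q_{c_j};q_3,p)_k}{\Theta(q_3;q_3,p)_k}:\!\Lambda_j(z)\Lambda_j(q_3^{-1}z)\cdots\Lambda_j(q_3^{-(k-1)}z)\!:\,q_3^{-kD_z},\qquad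 q_3^{D_z}g(z)=g(q_3z),$$ where $:\ :$ is normal ordering, and define the currents $T^{\vec c}_m(z;p)$ by $$:\!R_1(z)R_2(z)\cdots R_n(z)\!:\;=\sum_{m\ge0}(-1)^mT^{\vec c}_m(z;p)\,q_3^{-mD_z}.$$ **Products of currents.** Entries (in the monomial basis) of a product $\rho(E(z_1;p))\cdots\rho(E(z_m;p))$ are infinite sums over intermediate basis states. The product at a point of $\{(p,z_1,\dots,z_m):0<|p|<1,\ z_a\ne0\}$ is understood as follows: these sums converge absolutely when $|z_1|\gg|z_2|\gg\cdots\gg|z_m|\gg|pz_1|$, and one takes the meromorphic continuation of their value in $(p,z_1,\dots,z_m)$ to the given point. **Statement.** Let $m\ge1$ and assume $\theta_p(q_iq_3^k)\neq0$ for $i=1,2,3$ and $0\le k<m$. Put $$E_m(z;p)=E(q_3^{-m+1}z;p)E(q_3^{-m+2}z;p)\cdots E(z;p),\qquad u'_k=q_{c_k}^{-1/2}q_3^{1/2}\,\frac{\theta_p(q_1)\theta_p(q_2)}{(p;p)_\infty}\,u_k .$$ Then for every $z\neq0$ the entries of the image of $E_m(z;p)$ under $\rho^{\vec c}_{H,\vec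 u'}$ exist (the sums converge absolutely for widely separated arguments as above, and their continuations are regular at the point in question), and $$\rho^{\vec c}_{H,\vec u'}\big(E_m(z;p)\big)=T^{\vec c}_m(z;p).$$ In particular this holds for $\vec c=(1^L2^M3^N)$. -/

import Mathlib

noncomputable section

namespace EllCorner

/-! ### Theta functions -/

/-- `(x ; p)_∞ = ∏_{k ≥ 0} (1 - p ^ k x)`. -/
def qPoch (x p : ℂ) : ℂ := ∏' k : ℕ, (1 - p ^ k * x)

/-- `θ_p(z) = (z ; p)_∞ (p z⁻¹ ; p)_∞`. -/
def theta (p z : ℂ) : ℂ := qPoch z p * qPoch (p * z⁻¹) p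

/-- `Θ(z ; q, p)_k = ∏_{j = 0}^{k - 1} θ_p(q ^ j z)` for `k ≥ 0`. -/
def thetaPoch (z q p : ℂ) (k : ℕ) : ℂ := ∏ j ∈ Finset.range k, theta p (q ^ j * z)

/-! ### Parameters

The indices `1, 2, 3` of `q₁, q₂, q₃` are the elements `0, 1, 2` of `Fin 3`.
Everything is expressed through chosen fourth roots `r i = q_i ^ (1/4)`. -/

/-- `q_i`. -/
def q (r : Fin 3 → ℂ) (i : Fin 3) : ℂ := r i ^ 4

/-- `q_i ^ (1/2)`. -/
def qh (r : Fin 3 → ℂ) (i : Fin 3) : ℂ := r i ^ 2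

/-- `κ_n = (q₁ ^ n - 1) (q₂ ^ n - 1) (q₃ ^ n - 1)`. -/
def kap (r : Fin 3 → ℂ) (n : ℕ) : ℂ := (q r 0 ^ n - 1) * (q r 1 ^ n - 1) * (q r 2 ^ n - 1)

/-- `q_i ^ (n/2) - q_i ^ (-n/2)`. -/
def qdiff (r : Fin 3 → ℂ) (i : Fin 3) (n : ℕ) : ℂ := qh r i ^ n - (qh r i ^ n)⁻¹

/-! ### Heisenberg algebra and Fock space -/

/-- The modes of one Heisenberg algebra: `inl n` stands for the pair `a_{±n}`, and `inr n` for the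
pair `b_{±n}`, where `n ≥ 1`. -/
abbrev Mode := ℕ+ ⊕ ℕ+

/-- Occupation numbers; they label the monomial basis
`a_{-λ₁} ⋯ a_{-λ_k} b_{-μ₁} ⋯ b_{-μ_l} |0⟩` of the Fock space. -/
abbrev State := Mode →₀ ℕ

/-- The Fock space with its monomial basis: `a_{-n}` and `b_{-n}` act by multiplication by
the variables. -/
abbrev Fock := MvPolynomial Mode ℂ

/-- The commutators `[a_n, a_{-n}]` and `[b_n, b_{-n}]` for `n ≥ 1` in the `i`-th elliptic
Heisenberg algebra; all other commutators of modes vanish. -/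
def heisComm (r : Fin 3 → ℂ) (p : ℂ) (i : Fin 3) : Mode → ℂ
  | Sum.inl n => ((n : ℕ) : ℂ) / kap r n * qdiff r i n * (1 - p ^ (n : ℕ))
  | Sum.inr n => ((n : ℕ) : ℂ) / kap r n * qdiff r i n * ((1 - p ^ (n : ℕ)) / p ^ (n : ℕ))

/-- The action of `∑_j d_j x_j` on the Fock space, where `x_j` runs over the annihilation modes
`a_n`, `b_n` (`n ≥ 1`). The mode `x_j` kills the vacuum and has constant commutator
with `x_{-j}`, so it acts by a derivation. -/
def annSum (comm d : Mode → ℂ) : Derivation ℂ Fock Fock :=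
  MvPolynomial.mkDerivation ℂ fun j => MvPolynomial.C (d j * comm j)

/-- The exponential `exp (∑_j d_j x_j)` of annihilation modes: as the exponential of the
derivation `annSum comm d`, it is the translation `X_j ↦ X_j + d_j [x_j, x_{-j}]`. -/
def expAnn (comm d : Mode → ℂ) : Fock →ₐ[ℂ] Fock :=
  MvPolynomial.aeval fun j => MvPolynomial.X j + MvPolynomial.C (d j * comm j)

/-- `expAnn` is the (locally finite) exponential series of `annSum`. -/
theorem expAnn_eq_exp (comm d : Mode → ℂ) (v : Fock) :
    ∃ N₀ : ℕ, ∀ N ≥ N₀, ((annSum comm d : Fock →ₗ[ℂ] Fock) ^ N) v = 0 ∧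
      expAnn comm d v = ∑ k ∈ Finset.range N,
        ((k.factorial : ℂ)⁻¹) • ((annSum comm d : Fock →ₗ[ℂ] Fock) ^ k) v := by
  induction v using MvPolynomial.induction_on with
  | C a =>
    have h0 : ∀ k : ℕ, ((annSum comm d : Fock →ₗ[ℂ] Fock) ^ (k + 1)) (MvPolynomial.C a) = 0 := by
      intro k
      rw [pow_succ, Module.End.mul_apply]
      have : (annSum comm d : Fock →ₗ[ℂ] Fock) (MvPolynomial.C a) = 0 := by
        simp [annSum]
      rw [this, map_zero]
    refine ⟨1, fun N hN => ?_⟩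
    obtain ⟨N, rfl⟩ : ∃ M, N = M + 1 := ⟨N - 1, by omega⟩
    refine ⟨h0 N, ?_⟩
    rw [Finset.sum_range_succ']
    simp only [h0]
    simp [expAnn]
  | add v w hv hw =>
    obtain ⟨N₁, h₁⟩ := hv
    obtain ⟨N₂, h₂⟩ := hw
    refine ⟨max N₁ N₂, fun N hN => ?_⟩
    obtain ⟨a₁, b₁⟩ := h₁ N (le_trans (le_max_left _ _) hN)
    obtain ⟨a₂, b₂⟩ := h₂ N (le_trans (le_max_right _ _) hN)
    refine ⟨by rw [map_add, a₁, a₂, add_zero], ?_⟩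
    rw [map_add, b₁, b₂, ← Finset.sum_add_distrib]
    simp only [map_add, smul_add]
  | mul_X v j hv =>
    obtain ⟨N₁, h₁⟩ := hv
    have hD : ∀ w : Fock, (annSum comm d : Fock →ₗ[ℂ] Fock) (w * MvPolynomial.X j) =
        (annSum comm d : Fock →ₗ[ℂ] Fock) w * MvPolynomial.X j + (d j * comm j) • w := by
      intro w
      simp [annSum, MvPolynomial.smul_eq_C_mul]
      ring
    have hL : ∀ k : ℕ, ((annSum comm d : Fock →ₗ[ℂ] Fock) ^ (k + 1)) (v * MvPolynomial.X j) =
        ((annSum comm d : Fock →ₗ[ℂ] Fock) ^ (k + 1)) v * MvPolynomial.X j +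
          (((k + 1 : ℕ) : ℂ) * (d j * comm j)) •
            ((annSum comm d : Fock →ₗ[ℂ] Fock) ^ k) v := by
      intro k
      induction k with
      | zero => simpa using hD v
      | succ k ih =>
        rw [pow_succ', Module.End.mul_apply, ih, map_add, hD, map_smul, ← Module.End.mul_apply,
          ← pow_succ', ← Module.End.mul_apply, ← pow_succ', add_assoc, ← add_smul]
        congr 2
        push_cast
        ring
    refine ⟨N₁ + 1, fun N hN => ?_⟩
    obtain ⟨N, rfl⟩ : ∃ M, N = M + 1 := ⟨N - 1, by omega⟩
    obtain ⟨a₁, b₁⟩ := h₁ N (by omega)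
    obtain ⟨a₂, b₂⟩ := h₁ (N + 1) (by omega)
    refine ⟨by rw [hL, a₁, a₂]; simp, ?_⟩
    rw [map_mul]
    have hX : expAnn comm d (MvPolynomial.X j) =
        MvPolynomial.X j + MvPolynomial.C (d j * comm j) := by simp [expAnn]
    rw [hX, mul_add]
    nth_rewrite 1 [b₂]
    rw [b₁, Finset.sum_range_succ', Finset.sum_range_succ']
    simp only [hL]
    simp only [smul_add, Finset.sum_add_distrib, add_mul, Finset.sum_mul, pow_zero,
      Module.End.one_apply, Nat.factorial_zero, Nat.cast_one, inv_one, one_smul, smul_mul_assoc]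
    rw [add_right_comm]
    congr 2
    refine Finset.sum_congr rfl fun k _ => ?_
    rw [mul_comm _ (MvPolynomial.C _), ← MvPolynomial.smul_eq_C_mul, smul_smul, smul_smul]
    congr 1
    rw [Nat.factorial_succ]
    have h1 : ((k : ℂ) + 1) ≠ 0 := by exact_mod_cast Nat.succ_ne_zero k
    have h2 : (k.factorial : ℂ) ≠ 0 := by exact_mod_cast k.factorial_ne_zero
    push_cast
    field_simp

/-- The exponential `exp (∑_j c_j x_{-j})` of creation modes, as a formal power series in the
(commuting) creation modes: the product over `j` of `∑_k c_j ^ k X_j ^ k / k!`. -/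
def expCre (c : Mode → ℂ) : MvPowerSeries Mode ℂ :=
  fun γ => γ.prod fun j k => c j ^ k / (k.factorial : ℂ)

/-- The exponents of a normally ordered exponential `exp (∑_j c_j x_{-j}) exp (∑_j d_j x_j)`:
the pair `(c, d)` of coefficients of the creation and of the annihilation modes. -/
abbrev Exponent := (Mode → ℂ) × (Mode → ℂ)

/-- The matrix, in the monomial basis, of `exp (∑_j c_j x_{-j}) exp (∑_j d_j x_j)`. This is a map
from the Fock space to its completion (all formal infinite combinations of basis vectors). -/
def expOp (comm : Mode → ℂ) (e : Exponent) : Matrix State State ℂ := fun β α =>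
  MvPowerSeries.coeff β
    (expCre e.1 * (expAnn comm e.2 (MvPolynomial.monomial α 1) : MvPowerSeries Mode ℂ))

/-! ### Horizontal Fock representations and the coproduct -/

/-- The images of the generating currents `E(z;p), F(z;p), K⁺(z;p), K⁻(z;p)` and of the central
element `C` (acting by a scalar) of the elliptic toroidal `gl₁` algebra in a representation on
a space with basis `ι`. For each `z` a current is a matrix in that basis. -/
structure Currents (ι : Type) where
  E : ℂ → Matrix ι ι ℂ
  F : ℂ → Matrix ι ι ℂ
  Kp : ℂ → Matrix ι ι ℂ
  Km : ℂ → Matrix ι ι ℂ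
  C : ℂ

open scoped Kronecker in
/-- The tensor product of two representations, given by the coproduct
`Δ E(z) = E(z) ⊗ 1 + K⁻(C₁ z) ⊗ E(C₁ z)`, `Δ F(z) = F(C₂ z) ⊗ K⁺(C₂ z) + 1 ⊗ F(z)`,
`Δ K⁺(z) = K⁺(z) ⊗ K⁺(C₁⁻¹ z)`, `Δ K⁻(z) = K⁻(C₂⁻¹ z) ⊗ K⁻(z)`, `Δ C = C ⊗ C`. -/
def Currents.tensor {ι κ : Type} [DecidableEq ι] [DecidableEq κ]
    (V : Currents ι) (W : Currents κ) : Currents (ι × κ) where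
  E z := V.E z ⊗ₖ 1 + V.Km (V.C * z) ⊗ₖ W.E (V.C * z)
  F z := V.F (W.C * z) ⊗ₖ W.Kp (W.C * z) + 1 ⊗ₖ W.F z
  Kp z := V.Kp z ⊗ₖ W.Kp (V.C⁻¹ * z)
  Km z := V.Km (W.C⁻¹ * z) ⊗ₖ W.Km z
  C := V.C * W.C

/-- Relabelling of the basis. -/
def Currents.relabel {ι κ : Type} (V : Currents ι) (f : κ ≃ ι) : Currents κ where
  E z := (V.E z).submatrix f f
  F z := (V.F z).submatrix f f
  Kp z := (V.Kp z).submatrix f f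
  Km z := (V.Km z).submatrix f f
  C := V.C

/-- The trivial representation, given by the counit. -/
def Currents.trivial (ι : Type) [DecidableEq ι] : Currents ι where
  E _ := 0
  F _ := 0
  Kp _ := 1
  Km _ := 1
  C := 1

/-- The exponents of `φ^{-(i)}(z;p)`. -/
def phiExp (r : Fin 3 → ℂ) (p : ℂ) (i : Fin 3) (z : ℂ) : Exponent :=
  (fun
    | Sum.inl n => -(1 / (1 - p ^ (n : ℕ)) * (kap r n / (n : ℕ)) * (r i ^ (n : ℕ))⁻¹ * z ^ (n : ℕ))
    | Sum.inr n =>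
        p ^ (n : ℕ) / (1 - p ^ (n : ℕ)) * (kap r n / (n : ℕ)) * r i ^ (n : ℕ) * (z ^ (n : ℕ))⁻¹,
   0)

/-- The exponents of `K⁺(z;p)` in the `i`-th horizontal Fock representation. -/
def kpExp (r : Fin 3 → ℂ) (p : ℂ) (i : Fin 3) (z : ℂ) : Exponent :=
  (0,
   fun
    | Sum.inl n => 1 / (1 - p ^ (n : ℕ)) * (kap r n / (n : ℕ)) * r i ^ (n : ℕ) * (z ^ (n : ℕ))⁻¹
    | Sum.inr n =>
        -(p ^ (n : ℕ) / (1 - p ^ (n : ℕ)) * (kap r n / (n : ℕ)) * (r i ^ (n : ℕ))⁻¹ * z ^ (n : ℕ)))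

/-- The exponents of `η^{(i)}(z;p)`. -/
def etaExp (r : Fin 3 → ℂ) (p : ℂ) (i : Fin 3) (z : ℂ) : Exponent :=
  (fun
    | Sum.inl n =>
        1 / (1 - p ^ (n : ℕ)) * (kap r n / (n : ℕ)) * ((r i ^ (n : ℕ))⁻¹ / qdiff r i n)
          * z ^ (n : ℕ)
    | Sum.inr n =>
        p ^ (n : ℕ) / (1 - p ^ (n : ℕ)) * (kap r n / (n : ℕ)) * (r i ^ (n : ℕ) / qdiff r i n)
          * (z ^ (n : ℕ))⁻¹,
   fun
    | Sum.inl n =>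
        -(1 / (1 - p ^ (n : ℕ)) * (kap r n / (n : ℕ)) * (r i ^ (n : ℕ) / (q r i ^ (n : ℕ) - 1))
          * (z ^ (n : ℕ))⁻¹)
    | Sum.inr n =>
        p ^ (n : ℕ) / (1 - p ^ (n : ℕ)) * (kap r n / (n : ℕ))
          * ((r i ^ (n : ℕ))⁻¹ / ((q r i ^ (n : ℕ))⁻¹ - 1)) * z ^ (n : ℕ))

/-- The exponents of `F(z;p)` in the `i`-th horizontal Fock representation. -/
def xiExp (r : Fin 3 → ℂ) (p : ℂ) (i : Fin 3) (z : ℂ) : Exponent :=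
  (fun
    | Sum.inl n =>
        -(1 / (1 - p ^ (n : ℕ)) * (kap r n / (n : ℕ)) * (r i ^ (n : ℕ) / qdiff r i n)
          * z ^ (n : ℕ))
    | Sum.inr n =>
        -(p ^ (n : ℕ) / (1 - p ^ (n : ℕ)) * (kap r n / (n : ℕ)) * ((r i ^ (n : ℕ))⁻¹ / qdiff r i n)
          * (z ^ (n : ℕ))⁻¹),
   fun
    | Sum.inl n =>
        1 / (1 - p ^ (n : ℕ)) * (kap r n / (n : ℕ)) * (r i ^ (n : ℕ) / qdiff r i n)
          * (z ^ (n : ℕ))⁻¹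
    | Sum.inr n =>
        p ^ (n : ℕ) / (1 - p ^ (n : ℕ)) * (kap r n / (n : ℕ)) * ((r i ^ (n : ℕ))⁻¹ / qdiff r i n)
          * z ^ (n : ℕ))

/-- `d̃₁ = (p;p)_∞ / (θ_p(q_{i'}) θ_p(q_{i''}))`, where `{i, i', i''} = {1, 2, 3}`. -/
def dTilde₁ (r : Fin 3 → ℂ) (p : ℂ) (i : Fin 3) : ℂ :=
  qPoch p p / ∏ j ∈ Finset.univ.erase i, theta p (q r j)

/-- `d̃₂ = (p;p)_∞ θ_p(q_i⁻¹) / ((q₁ - 1) (q₂ - 1) (q₃ - 1))`. -/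
def dTilde₂ (r : Fin 3 → ℂ) (p : ℂ) (i : Fin 3) : ℂ :=
  qPoch p p * theta p (q r i)⁻¹ / kap r 1

/-- The horizontal Fock representation `ρ_{H,u}^{(i)}`. -/
def fockRep (r : Fin 3 → ℂ) (p : ℂ) (i : Fin 3) (u : ℂ) : Currents State where
  E z := (u * dTilde₁ r p i) • expOp (heisComm r p i) (etaExp r p i z)
  F z := (u⁻¹ * dTilde₂ r p i) • expOp (heisComm r p i) (xiExp r p i z)
  Kp z := expOp (heisComm r p i) (kpExp r p i z)
  Km z := expOp (heisComm r p i) (phiExp r p i z)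
  C := qh r i

/-- The tensor product `ρ_{H,u}^{c} = (ρ_{H,u₁}^{(c₁)} ⊗ ⋯ ⊗ ρ_{H,u_n}^{(c_n)}) ∘ Δ^{(n-1)}`. Since
`Δ^{(k)} = (Δ^{(k-1)} ⊗ 1) ∘ Δ`, the last factor is split off first. The basis of
the tensor product is labelled by `n`-tuples of basis states. -/
def tensorRep (r : Fin 3 → ℂ) (p : ℂ) :
    (n : ℕ) → (Fin n → Fin 3) → (Fin n → ℂ) → Currents (Fin n → State)
  | 0, _, _ => Currents.trivial _
  | n + 1, c, u =>
      ((tensorRep r p n (Fin.init c) (Fin.init u)).tensor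
        (fockRep r p (c (Fin.last n)) (u (Fin.last n)))).relabel
        ((Fin.snocEquiv fun _ => State).symm.trans (Equiv.prodComm _ _))

/-- The rescaled parameters
`u'_k = q_{c_k}^{-1/2} q₃^{1/2} θ_p(q₁) θ_p(q₂) / (p;p)_∞ · u_k`. -/
def uPrime (r : Fin 3 → ℂ) (p : ℂ) {n : ℕ} (c : Fin n → Fin 3) (u : Fin n → ℂ) : Fin n → ℂ :=
  fun k => (qh r (c k))⁻¹ * qh r 2 * (theta p (q r 0) * theta p (q r 1) / qPoch p p) * u k

/-! ### Normally ordered expressions and the elliptic Miura transformation -/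

/-- Finite linear combinations of normally ordered exponentials on the `n`-fold tensor product.
Each normally ordered exponential is given by its exponents in the `n` tensor factors, and the
product of this commutative algebra, which adds exponents, is the normally ordered product. -/
abbrev Normal (n : ℕ) := AddMonoidAlgebra ℂ (Fin n → Exponent)

/-- The operator (as a matrix in the monomial basis) given by a normally ordered expression. -/
def toOp (r : Fin 3 → ℂ) (p : ℂ) {n : ℕ} (c : Fin n → Fin 3) (x : Normal n) :
    Matrix (Fin n → State) (Fin n → State) ℂ := fun β α =>
  x.coeff.sum fun e a => a * ∏ k, expOp (heisComm r p (c k)) (e k) (β k) (α k)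

/-- The elliptic vertex operator
`Λ_j(z) = u_j φ⁻(q_{c₁}^{1/2} z) ⊗ ⋯ ⊗ φ⁻(q_{c₁}^{1/2} ⋯ q_{c_{j-1}}^{1/2} z)
  ⊗ η(q_{c₁}^{1/2} ⋯ q_{c_{j-1}}^{1/2} z) ⊗ 1 ⊗ ⋯ ⊗ 1`. -/
def vertexOp (r : Fin 3 → ℂ) (p : ℂ) {n : ℕ} (c : Fin n → Fin 3) (u : Fin n → ℂ)
    (j : Fin n) (z : ℂ) : Normal n :=
  AddMonoidAlgebra.single
    (fun k =>
      if k < j then phiExp r p (c k) ((∏ i ∈ Finset.Iic k, qh r (c i)) * z)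
      else if k = j then etaExp r p (c k) ((∏ i ∈ Finset.Iio k, qh r (c i)) * z)
      else 0)
    (u j)

/-- Difference operators `∑_{k ≥ 0} A_k(z) q₃^{-k D_z}` with normally ordered coefficients,
where `q₃^{D_z} g(z) = g(q₃ z)`. -/
abbrev DiffOp (n : ℕ) := ℕ → ℂ → Normal n

/-- The normally ordered product of difference operators: the rule is
`:(A(z) q₃^{-k D_z}) (B(z) q₃^{-l D_z}): = :A(z) B(q₃^{-k} z): q₃^{-(k+l) D_z}`. -/
def DiffOp.mul (r : Fin 3 → ℂ) {n : ℕ} (A B : DiffOp n) : DiffOp n := fun m z =>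
  ∑ kl ∈ Finset.HasAntidiagonal.antidiagonal m, A kl.1 z * B kl.2 ((q r 2 ^ kl.1)⁻¹ * z)

/-- The identity difference operator. -/
def DiffOp.one (n : ℕ) : DiffOp n := fun m _ => if m = 0 then 1 else 0

/-- The Miura factor `R_i^{(c_i)}(z;p)`. -/
def miuraFactor (r : Fin 3 → ℂ) (p : ℂ) {n : ℕ} (c : Fin n → Fin 3) (u : Fin n → ℂ)
    (i : Fin n) : DiffOp n := fun k z =>
  ((-1) ^ k * qh r 2 ^ (k ^ 2) * (qh r (c i) ^ k)⁻¹ *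
      (thetaPoch (q r 2 ^ (1 - (k : ℤ)) * q r (c i)) (q r 2) p k / thetaPoch (q r 2) (q r 2) p k)) •
    ∏ j ∈ Finset.range k, vertexOp r p c u i ((q r 2 ^ j)⁻¹ * z)

/-- The normally ordered product `:R₁(z;p) R₂(z;p) ⋯ R_n(z;p):`. -/
def miura (r : Fin 3 → ℂ) (p : ℂ) {n : ℕ} (c : Fin n → Fin 3) (u : Fin n → ℂ) : DiffOp n :=
  (List.ofFn fun i => miuraFactor r p c u i).foldl (DiffOp.mul r) (DiffOp.one n)

/-- The current `T_m(z;p)`, defined by `:R₁ ⋯ R_n: = ∑_m (-1)^m T_m(z;p) q₃^{-m D_z}`. -/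
def currentT (r : Fin 3 → ℂ) (p : ℂ) {n : ℕ} (c : Fin n → Fin 3) (u : Fin n → ℂ)
    (m : ℕ) (z : ℂ) : Normal n :=
  (-1) ^ m * miura r p c u m z

/-! ### Products of currents

A current maps the Fock space to its completion, so that matrix entries of a product of currents
are infinite sums over intermediate basis states. They converge for widely separated arguments
`|z₁| ≫ |z₂| ≫ ⋯ ≫ |z_m| ≫ |p z₁|` and are continued analytically from there. -/

/-- The domain `{(p, z₁, …, z_m) : 0 < |p| < 1, z_a ≠ 0}`. -/
def domain (m : ℕ) : Set (ℂ × (Fin m → ℂ)) :=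
  {x | x.1 ≠ 0 ∧ ‖x.1‖ < 1 ∧ ∀ a, x.2 a ≠ 0}

/-- The part `|z₁| ≫ |z₂| ≫ ⋯ ≫ |z_m| ≫ |p z₁|` of the domain, with separation at least `R`. -/
def radial (m : ℕ) (R : ℝ) : Set (ℂ × (Fin m → ℂ)) :=
  {x ∈ domain m | (∀ a b, a < b → R * ‖x.2 b‖ ≤ ‖x.2 a‖) ∧ ∀ a b, R * ‖x.1 * x.2 a‖ ≤ ‖x.2 b‖}

/-- Matrix multiplication `(A₁ ⋯ A_m)_{βα} = v` for infinite matrices, as an absolutely convergent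
sum over all sequences of basis states that lead from `β` to `α`. -/
def HasProductEntry {ι : Type} {m : ℕ} (A : Fin m → Matrix ι ι ℂ) (β α : ι) (v : ℂ) : Prop :=
  HasSum (fun γ : {γ : Fin (m + 1) → ι // γ 0 = β ∧ γ (Fin.last m) = α} =>
    ∏ a : Fin m, A a (γ.1 a.castSucc) (γ.1 a.succ)) v

/-- For a current `A p z`, the product `A p z₁ ⋯ A p z_m` is regular at the point `(p, z₁, …, z_m)`
and its entry at `(β, α)` has the value `v` there. That is, the entry converges absolutely for
widely separated arguments, is there the restriction of a meromorphic function `N / D` on the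
whole (connected) domain, the denominator `D` does not vanish at the given point,
and `N / D` takes the value `v` at that point. -/
def HasContinuedProductEntry {ι : Type} (A : ℂ → ℂ → Matrix ι ι ℂ) {m : ℕ}
    (p : ℂ) (z : Fin m → ℂ) (β α : ι) (v : ℂ) : Prop :=
  (p, z) ∈ domain m ∧
  ∃ N D : ℂ × (Fin m → ℂ) → ℂ,
    DifferentiableOn ℂ N (domain m) ∧ DifferentiableOn ℂ D (domain m) ∧
    (∃ R : ℝ, ∀ x ∈ radial m R, ∃ s : ℂ,
      HasProductEntry (fun a => A x.1 (x.2 a)) β α s ∧ D x * s = N x) ∧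
    D (p, z) ≠ 0 ∧ v = N (p, z) / D (p, z)

end EllCorner

end

noncomputable section

namespace EllCorner

open MvPolynomial

/-! ### Matrix entries of normally ordered exponentials -/

/-! The coproduct turns `E(z)` into a sum over `j` of multiples of the vertex operators `Λ_j(z)`
(`tensorRep_E`), so a product of `m` currents is a sum over words `J : Fin m → Fin n`. Each word
gives a product of normally ordered exponentials, that is, one normally ordered exponential times a
scalar for every pair `a < b`, the exponential of the commutator of the annihilation part on the
left with the creation part on the right (`hasSum_expEntry_mul`, `hasProductEntry_tensorEntry`).
Absolute convergence comes from the same formula: replacing all exponents by their norms gives a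
majorant of the same shape.

Since `q₁ q₂ q₃ = 1`, the exponent of a pair is a signed sum of six series for `log θ_p`. Its
exponential is a quotient of theta functions of the ratio `z_b / z_a` (`contraction_vertexExp`), and
the six series converge when the arguments are widely separated. Numerators, denominators and
normally ordered entries are holomorphic on the whole domain, so the quotient is the required
continuation (`hasContinuedProductEntry_tensorRep`).

At `z_a = q₃^(-m+1+a) z` the ratios are `q₃^(b-a)`, and the hypothesis on `θ_p(q_i q₃^k)` says that
no denominator vanishes there. Three things happen to the scalars. A pair of sites `j > k`
contributes `1`. Neighbouring letters `j < k` contribute a factor `θ_p(q₃⁻¹ q₃) = θ_p(1) = 0`, so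
only non-increasing words survive (`listTerm_eq_zero`). A block of `l` equal letters contributes a
product that telescopes, by the reflection `θ_p(x⁻¹) = -x⁻¹ θ_p(x)`, to the coefficient of the Miura
factor (`theta_telescope`, `prod_blockStep`). A non-increasing word is a choice of block lengths,
and choosing block lengths is expanding `:R₁ ⋯ R_n:` (`sumLists_listTerm`); a block of the largest
letter stands at the arguments shifted by the length of the remaining word, which is the shift made
by the difference operators. -/

theorem state_induction {P : State → Prop} (h0 : P 0)
    (h1 : ∀ γ j, P γ → P (γ + Finsupp.single j 1)) (γ : State) : P γ := by
  have key : ∀ f : State, ∀ γ, P γ → P (γ + f) := by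
    intro f
    induction f using Finsupp.induction_linear with
    | zero => intro γ h; simpa using h
    | add f g hf hg => intro γ h; rw [← add_assoc]; exact hg _ (hf _ h)
    | single j k =>
      induction k with
      | zero => intro γ h; simpa using h
      | succ k ih => intro γ h; rw [Finsupp.single_add, ← add_assoc]; exact h1 _ _ (ih _ h)
  simpa using key γ 0 h0

/-- The translation `X_j ↦ X_j + t_j`. -/
def shift (t : Mode → ℂ) : Fock →ₐ[ℂ] Fock := aeval fun j => X j + C (t j)

/-- The coefficient at `β` of `exp (∑ c_j x_{-j})` applied to the translate of `f` by `t`. -/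
def expEntry (c t : Mode → ℂ) (β : State) (f : Fock) : ℂ :=
  MvPowerSeries.coeff β (expCre c * (shift t f : MvPowerSeries Mode ℂ))

theorem expOp_eq (comm : Mode → ℂ) (e : Exponent) (β α : State) :
    expOp comm e β α = expEntry e.1 (fun j => e.2 j * comm j) β (monomial α 1) := rfl

theorem expEntry_C (c t : Mode → ℂ) (β : State) (a : ℂ) :
    expEntry c t β (C a) = a * MvPowerSeries.coeff β (expCre c) := by
  simp [expEntry, mul_comm]

theorem expEntry_add (c t : Mode → ℂ) (β : State) (f g : Fock) :
    expEntry c t β (f + g) = expEntry c t β f + expEntry c t β g := by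
  simp [expEntry, mul_add]

theorem expEntry_smul (c t : Mode → ℂ) (β : State) (a : ℂ) (f : Fock) :
    expEntry c t β (a • f) = a * expEntry c t β f := by
  simp [expEntry, MvPolynomial.smul_eq_C_mul, mul_left_comm _ (MvPowerSeries.C a)]

theorem coeff_mul_X_add (f : MvPowerSeries Mode ℂ) (j : Mode) (β : State) :
    MvPowerSeries.coeff (β + Finsupp.single j 1) (f * MvPowerSeries.X j) =
      MvPowerSeries.coeff β f := by
  rw [MvPowerSeries.X, MvPowerSeries.coeff_add_mul_monomial, mul_one]

theorem coeff_mul_X_of_eq_zero (f : MvPowerSeries Mode ℂ) (j : Mode) (β : State) (h : β j = 0) :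
    MvPowerSeries.coeff β (f * MvPowerSeries.X j) = 0 := by
  classical
  rw [MvPowerSeries.X, MvPowerSeries.coeff_mul_monomial, if_neg]
  intro h'
  have := h' j
  simp [h] at this

theorem expEntry_mul_X_of_eq_zero (c t : Mode → ℂ) (β : State) (f : Fock) (j : Mode)
    (h : β j = 0) : expEntry c t β (f * X j) = t j * expEntry c t β f := by
  simp only [expEntry, map_mul]
  rw [show shift t (X j) = X j + C (t j) by simp [shift]]
  rw [MvPolynomial.coe_mul, MvPolynomial.coe_add, MvPolynomial.coe_X, MvPolynomial.coe_C, ← mul_assoc,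
    mul_add, map_add, coeff_mul_X_of_eq_zero _ _ _ h, mul_comm _ (MvPowerSeries.C _),
    MvPowerSeries.coeff_C_mul, zero_add]

theorem expEntry_mul_X_add (c t : Mode → ℂ) (β : State) (f : Fock) (j : Mode) :
    expEntry c t (β + Finsupp.single j 1) (f * X j) =
      t j * expEntry c t (β + Finsupp.single j 1) f + expEntry c t β f := by
  simp only [expEntry, map_mul]
  rw [show shift t (X j) = X j + C (t j) by simp [shift]]
  rw [MvPolynomial.coe_mul, MvPolynomial.coe_add, MvPolynomial.coe_X, MvPolynomial.coe_C, ← mul_assoc,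
    mul_add, map_add, coeff_mul_X_add, mul_comm _ (MvPowerSeries.C _),
    MvPowerSeries.coeff_C_mul, add_comm]

theorem exists_add_single (β : State) (j : Mode) (h : β j ≠ 0) :
    ∃ β' : State, β = β' + Finsupp.single j 1 :=
  ⟨β - Finsupp.single j 1, (tsub_add_cancel_of_le (by
    rw [Finsupp.single_le_iff]; omega)).symm⟩

theorem monomial_add_single_one (γ : State) (j : Mode) :
    (monomial (γ + Finsupp.single j 1) 1 : Fock) = monomial γ 1 * X j := by
  rw [X, monomial_mul, mul_one]

/-- The weight `∏_j x_j ^ ε_j / ε_j !`. -/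
theorem coeff_expCre (c : Mode → ℂ) (γ : State) : MvPowerSeries.coeff γ (expCre c) =
    γ.prod fun j k => c j ^ k / (k.factorial : ℂ) := rfl

theorem coeff_expCre_zero (c : Mode → ℂ) : MvPowerSeries.coeff (0 : State) (expCre c) = 1 := by
  rw [coeff_expCre, Finsupp.prod_zero_index]

/-- The differential equation `∂_j exp = c_j exp`, read off coefficientwise. -/
theorem coeff_expCre_add (c : Mode → ℂ) (γ : State) (j : Mode) :
    (γ j + 1 : ℂ) * MvPowerSeries.coeff (γ + Finsupp.single j 1) (expCre c) =
      c j * MvPowerSeries.coeff γ (expCre c) := by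
  classical
  simp only [coeff_expCre]
  rw [Finsupp.prod_of_support_subset (s := insert j γ.support), Finsupp.prod_of_support_subset
    (f := γ) (s := insert j γ.support) (Finset.subset_insert _ _)]
  · rw [← Finset.mul_prod_erase _ _ (Finset.mem_insert_self j _),
      ← Finset.mul_prod_erase _ _ (Finset.mem_insert_self j _), ← mul_assoc, ← mul_assoc]
    congr 1
    · have h1 : ((γ j : ℂ) + 1) ≠ 0 := by exact_mod_cast Nat.succ_ne_zero (γ j)
      have h2 : ((γ j).factorial : ℂ) ≠ 0 := by exact_mod_cast (γ j).factorial_ne_zero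
      simp [Nat.factorial_succ]
      field_simp
      ring
    · refine Finset.prod_congr rfl fun k hk => ?_
      have : j ≠ k := fun h => by simp [h] at hk
      simp [this]
  · simp
  · intro k hk
    by_cases h : k = j
    · simp [h]
    · simp only [Finsupp.mem_support_iff, Finsupp.add_apply, Finsupp.single_apply] at hk
      rw [if_neg (Ne.symm h)] at hk
      simpa [h] using hk
  · simp

/-- The Leibniz rule for `∂_j (exp(c · X) g)`, coefficientwise. With `pderiv_shift` it becomes a
recursion that lowers the row index of an entry. -/
theorem coeff_expCre_mul_add (c : Mode → ℂ) (j : Mode) (g : Fock) : ∀ β : State,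
    (β j + 1 : ℂ) * MvPowerSeries.coeff (β + Finsupp.single j 1)
        (expCre c * (g : MvPowerSeries Mode ℂ)) =
      c j * MvPowerSeries.coeff β (expCre c * (g : MvPowerSeries Mode ℂ)) +
        MvPowerSeries.coeff β (expCre c * (pderiv j g : MvPowerSeries Mode ℂ)) := by
  classical
  induction g using MvPolynomial.induction_on with
  | C a =>
    intro β
    simp only [MvPolynomial.coe_C, mul_comm _ (MvPowerSeries.C a), MvPowerSeries.coeff_C_mul]
    rw [mul_left_comm, coeff_expCre_add]
    simp
    ring
  | add f g hf hg =>
    intro β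
    simp only [MvPolynomial.coe_add, map_add, mul_add, hf, hg]
    ring
  | mul_X g k ih =>
    intro β
    rw [Derivation.leibniz, smul_eq_mul, smul_eq_mul, pderiv_X, MvPolynomial.coe_add, mul_add,
      map_add, mul_comm (X k)]
    simp only [MvPolynomial.coe_mul, MvPolynomial.coe_X, ← mul_assoc]
    by_cases hkj : k = j
    · subst hkj
      rw [coeff_mul_X_add, Pi.single_eq_same, MvPolynomial.coe_one, mul_one]
      by_cases hb : β k = 0
      · rw [coeff_mul_X_of_eq_zero _ _ _ hb, coeff_mul_X_of_eq_zero _ _ _ hb, hb]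
        simp
      · obtain ⟨β, rfl⟩ := exists_add_single β k hb
        rw [coeff_mul_X_add, coeff_mul_X_add]
        have := ih β
        simp only [Finsupp.add_apply, Finsupp.single_eq_same, Nat.cast_add, Nat.cast_one]
        linear_combination this
    · rw [Pi.single_eq_of_ne hkj, MvPolynomial.coe_zero, mul_zero, map_zero, zero_add]
      by_cases hb : β k = 0
      · rw [coeff_mul_X_of_eq_zero _ _ _ hb, coeff_mul_X_of_eq_zero _ _ _ hb,
          coeff_mul_X_of_eq_zero]
        · simp
        · simp [hb, Ne.symm hkj]
      · obtain ⟨β, rfl⟩ := exists_add_single β k hb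
        rw [add_right_comm, coeff_mul_X_add, coeff_mul_X_add, coeff_mul_X_add, ← ih]
        simp [hkj]

theorem pderiv_shift (t : Mode → ℂ) (j : Mode) (f : Fock) :
    pderiv j (shift t f) = shift t (pderiv j f) := by
  classical
  induction f using MvPolynomial.induction_on with
  | C a => simp [shift]
  | add f g hf hg => simp [hf, hg]
  | mul_X f k ih =>
    have h : shift t (X k) = X k + C (t k) := by simp [shift]
    by_cases hkj : k = j
    · subst hkj
      simp [h, ih]
    · simp [h, ih, pderiv_X, Pi.single_eq_of_ne hkj]

theorem expEntry_add_single (c t : Mode → ℂ) (β : State) (f : Fock) (j : Mode) :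
    (β j + 1 : ℂ) * expEntry c t (β + Finsupp.single j 1) f =
      c j * expEntry c t β f + expEntry c t β (pderiv j f) := by
  rw [expEntry, coeff_expCre_mul_add, pderiv_shift]; rfl

theorem expEntry_zero (c t : Mode → ℂ) (γ : State) :
    expEntry c t 0 (monomial γ 1) = γ.prod fun j k => t j ^ k := by
  classical
  rw [expEntry, MvPowerSeries.coeff_zero_eq_constantCoeff_apply, map_mul,
    ← MvPowerSeries.coeff_zero_eq_constantCoeff_apply, coeff_expCre_zero, one_mul,
    ← MvPowerSeries.coeff_zero_eq_constantCoeff_apply, MvPolynomial.coeff_coe]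
  rw [shift, aeval_monomial, map_one, one_mul, ← constantCoeff_eq, Finsupp.prod, map_prod]
  simp [Finsupp.prod]

theorem expEntry_zero_zero (β α : State) :
    expEntry 0 0 β (monomial α 1) = if β = α then 1 else 0 := by
  classical
  have h1 : expCre 0 = 1 := by
    ext γ
    rw [coeff_expCre, MvPowerSeries.coeff_one]
    split_ifs with h
    · simp [h]
    · obtain ⟨j, hj⟩ := Finsupp.ne_iff.1 h
      exact Finset.prod_eq_zero (i := j) (by simpa using hj) (by simp at hj; simp [hj])
  have h2 : shift 0 = AlgHom.id ℂ Fock := by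
    ext j; simp [shift]
  rw [expEntry, h1, h2, one_mul, AlgHom.id_apply, MvPolynomial.coeff_coe, coeff_monomial]
  simp [eq_comm]

/-- An entry is a polynomial with non-negative coefficients in the exponents, so taking norms of the
exponents majorizes it. This supplies the majorants for all later sums. -/
theorem expEntry_abs (c t : Mode → ℂ) (α : State) : ∀ β, ∃ y : ℝ, 0 ≤ y ∧
    expEntry (fun j => (‖c j‖ : ℂ)) (fun j => (‖t j‖ : ℂ)) β (monomial α 1) = y ∧
    ‖expEntry c t β (monomial α 1)‖ ≤ y := by
  induction α using state_induction with
  | h0 =>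
    intro β
    have : (monomial 0 1 : Fock) = C 1 := rfl
    simp only [this, expEntry_C, one_mul, coeff_expCre]
    refine ⟨β.prod fun j k => ‖c j‖ ^ k / k.factorial, ?_, ?_, ?_⟩
    · exact Finset.prod_nonneg fun j _ => by positivity
    · simp [Finsupp.prod]
    · simp [Finsupp.prod]
  | h1 γ j ih =>
    intro β
    simp only [monomial_add_single_one]
    obtain ⟨y, h0, h1, h2⟩ := ih β
    by_cases hb : β j = 0
    · simp only [expEntry_mul_X_of_eq_zero _ _ _ _ _ hb]
      refine ⟨‖t j‖ * y, by positivity, by rw [h1]; simp, ?_⟩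
      rw [norm_mul]
      gcongr
    · obtain ⟨β, rfl⟩ := exists_add_single β j hb
      obtain ⟨y', h0', h1', h2'⟩ := ih β
      simp only [expEntry_mul_X_add]
      refine ⟨‖t j‖ * y + y', by positivity, by rw [h1, h1']; simp, ?_⟩
      refine (norm_add_le _ _).trans ?_
      rw [norm_mul]
      gcongr

/-! ### Sums over intermediate states -/

theorem hasSum_of_eq {ι : Type*} {f g : ι → ℂ} {a b : ℂ} (h : HasSum f a) (hfg : ∀ x, g x = f x)
    (hab : b = a) : HasSum g b := by
  rw [hab, show g = f from funext hfg]; exact h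

theorem hasSum_mul {κ κ' : Type*} {f : κ → ℂ} {g : κ' → ℂ} {a b : ℂ} (hf : HasSum f a)
    (hg : HasSum g b) : HasSum (fun x : κ × κ' => f x.1 * g x.2) (a * b) := by
  have h1 : Summable fun x => ‖f x‖ := hf.summable.norm
  have h2 : Summable fun x => ‖g x‖ := hg.summable.norm
  exact hf.mul hg (summable_mul_of_summable_norm h1 h2)

theorem hasSum_prod_fin {κ : Type*} {n : ℕ} (f : Fin n → κ → ℂ) (a : Fin n → ℂ)
    (hf : ∀ k, HasSum (f k) (a k)) :
    HasSum (fun γ : Fin n → κ => ∏ k, f k (γ k)) (∏ k, a k) := by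
  induction n with
  | zero => simp
  | succ n ih =>
    rw [← (Fin.consEquiv fun _ : Fin (n + 1) => κ).hasSum_iff, Fin.prod_univ_succ]
    have h := ih (fun k => f k.succ) (fun k => a k.succ) fun k => hf k.succ
    refine hasSum_of_eq (hasSum_mul (hf 0) h) (fun x => ?_) rfl
    simp [Fin.prod_univ_succ, Fin.consEquiv]

theorem hasSum_prod_fintype {ι κ : Type*} [Fintype ι] (f : ι → κ → ℂ) (a : ι → ℂ)
    (hf : ∀ k, HasSum (f k) (a k)) :
    HasSum (fun γ : ι → κ => ∏ k, f k (γ k)) (∏ k, a k) := by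
  have e := Fintype.equivFin ι
  have h := hasSum_prod_fin (fun k => f (e.symm k)) (fun k => a (e.symm k)) fun k => hf _
  rw [← (e.arrowCongr (Equiv.refl κ)).hasSum_iff] at h
  rw [← e.symm.prod_comp a]
  refine h.congr_fun fun γ => ?_
  rw [← e.symm.prod_comp]
  simp

theorem hasSum_expCre_finset (x : Mode → ℂ) (s : Finset Mode) (hs : ∀ j ∉ s, x j = 0) :
    HasSum (fun ε : State => MvPowerSeries.coeff ε (expCre x)) (Complex.exp (∑ j ∈ s, x j)) := by
  classical
  have h := hasSum_prod_fintype (ι := s) (fun j k => x j ^ k / (k.factorial : ℂ))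
    (fun j => Complex.exp (x j)) fun j => by
      have := NormedSpace.expSeries_div_hasSum_exp (x j)
      rwa [← Complex.exp_eq_exp_ℂ] at this
  rw [Complex.exp_sum, ← Finset.prod_coe_sort s]
  -- States supported in `s` are tuples of occupation numbers, over which the sum factorizes into
  -- exponential series; any other state contains a factor `0 ^ k` with `k > 0`.
  let g : (s → ℕ) → State := fun f =>
    Finsupp.embDomain (Function.Embedding.subtype _) (Finsupp.equivFunOnFinite.symm f)
  have hg : Function.Injective g := fun f f' hff =>
    Finsupp.equivFunOnFinite.symm.injective (Finsupp.embDomain_injective _ hff)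
  rw [← hg.hasSum_iff]
  · refine h.congr_fun fun γ => ?_
    simp only [Function.comp, coeff_expCre, g]
    rw [Finsupp.prod_embDomain, Finsupp.prod_fintype _ _ (by simp)]
    rfl
  · intro ε hε
    rw [coeff_expCre]
    by_cases h : ε.support ⊆ s
    · refine absurd ⟨Finsupp.equivFunOnFinite (ε.subtypeDomain (· ∈ s)), ?_⟩ hε
      simp only [g, Equiv.symm_apply_apply]
      rw [← Finsupp.extendDomain_eq_embDomain_subtype]
      exact Finsupp.extendDomain_subtypeDomain _ fun a ha => h ha
    · obtain ⟨j, hj, hjs⟩ := Finset.not_subset.1 h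
      refine Finset.prod_eq_zero hj ?_
      simp only [hs j hjs]
      rw [zero_pow (Finsupp.mem_support_iff.1 hj), zero_div]

theorem norm_coeff_expCre (x : Mode → ℂ) (ε : State) :
    (‖MvPowerSeries.coeff ε (expCre x)‖ : ℂ) =
      MvPowerSeries.coeff ε (expCre fun j => (‖x j‖ : ℂ)) := by
  simp [coeff_expCre, Finsupp.prod]

theorem coeff_expCre_indicator (x : Mode → ℂ) (ε : State) (s : Finset Mode) (h : ε.support ⊆ s) :
    MvPowerSeries.coeff ε (expCre ((s : Set Mode).indicator x)) =
      MvPowerSeries.coeff ε (expCre x) := by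
  simp only [coeff_expCre]
  refine Finset.prod_congr rfl fun j hj => ?_
  simp [Set.indicator_of_mem (show j ∈ (s : Set Mode) from h hj)]

theorem norm_coeff_expCre_indicator_le (x : Mode → ℂ) (ε : State) (s : Finset Mode) :
    ‖MvPowerSeries.coeff ε (expCre ((s : Set Mode).indicator x))‖ ≤
      ‖MvPowerSeries.coeff ε (expCre x)‖ := by
  simp only [coeff_expCre, Finsupp.prod, norm_prod, norm_div, norm_pow]
  refine Finset.prod_le_prod (fun _ _ => by positivity) fun j _ => ?_
  gcongr
  exact norm_indicator_le_norm_self _ _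

theorem summable_expCre (x : Mode → ℂ) (hx : Summable x) :
    Summable fun ε : State => ‖MvPowerSeries.coeff ε (expCre x)‖ := by
  classical
  refine summable_of_sum_le (c := Real.exp (∑' j, ‖x j‖)) (fun _ => norm_nonneg _) fun u => ?_
  -- Finitely many states involve finitely many modes, so the finite case bounds every partial sum
  -- by the exponential of the sum of norms.
  set s : Finset Mode := u.biUnion Finsupp.support
  have h := hasSum_expCre_finset (fun j => (‖(s : Set Mode).indicator x j‖ : ℂ)) s
    fun j hj => by simp [hj]
  simp only [← norm_coeff_expCre, ← Complex.ofReal_sum, ← Complex.ofReal_exp] at h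
  rw [Complex.hasSum_ofReal] at h
  calc ∑ ε ∈ u, ‖MvPowerSeries.coeff ε (expCre x)‖
      = ∑ ε ∈ u, ‖MvPowerSeries.coeff ε (expCre ((s : Set Mode).indicator x))‖ :=
        Finset.sum_congr rfl fun ε hε => by
          rw [coeff_expCre_indicator _ _ _ (Finset.subset_biUnion_of_mem Finsupp.support hε)]
    _ ≤ _ := sum_le_hasSum u (fun _ _ => norm_nonneg _) h
    _ ≤ _ := by
      refine Real.exp_le_exp.2 ?_
      refine (Finset.sum_le_sum fun j _ => norm_indicator_le_norm_self _ _).trans ?_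
      exact hx.norm.sum_le_tsum s fun _ _ => norm_nonneg _

/-- Cutting `x` off outside a finite set of modes reduces to the finite case; dominated convergence
removes the cut-off, the dominating series being that of `summable_expCre`. -/
theorem hasSum_expCre (x : Mode → ℂ) (hx : Summable x) :
    HasSum (fun ε : State => MvPowerSeries.coeff ε (expCre x)) (Complex.exp (∑' j, x j)) := by
  classical
  have hsum := (summable_expCre x hx).of_norm
  have h1 := tendsto_tsum_of_dominated_convergence (𝓕 := Filter.atTop)
    (f := fun (s : Finset Mode) (ε : State) =>
      MvPowerSeries.coeff ε (expCre ((s : Set Mode).indicator x)))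
    (summable_expCre x hx) (fun ε => tendsto_const_nhds.congr' (by
      filter_upwards [Filter.eventually_ge_atTop ε.support] with s hs
      exact (coeff_expCre_indicator x ε s hs).symm))
    (Filter.Eventually.of_forall fun s ε => norm_coeff_expCre_indicator_le x ε s)
  have h2 : Filter.Tendsto (fun s : Finset Mode => Complex.exp (∑ j ∈ s, x j)) Filter.atTop
      (nhds (Complex.exp (∑' j, x j))) := (Complex.continuous_exp.tendsto _).comp hx.hasSum
  rw [hsum.hasSum_iff]
  refine tendsto_nhds_unique h1 (h2.congr fun s => ?_)
  rw [(hasSum_expCre_finset ((s : Set Mode).indicator x) s fun j hj => by simp [hj]).tsum_eq]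
  congr 1
  exact Finset.sum_congr rfl fun j hj => by simp [hj]

theorem prod_pow_mul_coeff_expCre (t c : Mode → ℂ) (γ : State) :
    (γ.prod fun j k => t j ^ k) * MvPowerSeries.coeff γ (expCre c) =
      MvPowerSeries.coeff γ (expCre fun j => t j * c j) := by
  simp only [coeff_expCre, Finsupp.prod, ← Finset.prod_mul_distrib]
  exact Finset.prod_congr rfl fun j _ => by rw [mul_pow, mul_div_assoc]

theorem pderiv_monomial_mul_expCre (c t c' : Mode → ℂ) (β γ : State) (j : Mode) :
    expEntry c t β (pderiv j (monomial (γ + Finsupp.single j 1) 1)) *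
        MvPowerSeries.coeff (γ + Finsupp.single j 1) (expCre c') =
      c' j * (expEntry c t β (monomial γ 1) * MvPowerSeries.coeff γ (expCre c')) := by
  have h : (pderiv j (monomial (γ + Finsupp.single j 1) 1) : Fock) =
      (γ j + 1 : ℂ) • monomial γ 1 := by
    rw [pderiv_monomial, smul_monomial]
    simp
  rw [h, expEntry_smul]
  linear_combination expEntry c t β (monomial γ 1) * coeff_expCre_add c' γ j

theorem add_single_injective (j : Mode) :
    Function.Injective fun γ : State => γ + Finsupp.single j 1 := add_left_injective _

/-- The composition formula applied to the vacuum. The row of the vacuum gives the exponential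
series in the products `t₁ j * c₂ j`, which is where the commutator scalar arises; the Leibniz
recursion then climbs to every row. -/
theorem hasSum_expEntry_mul_expCre (c₁ t₁ c₂ : Mode → ℂ) (h : Summable fun j => t₁ j * c₂ j)
    (β : State) :
    HasSum (fun γ => expEntry c₁ t₁ β (monomial γ 1) * MvPowerSeries.coeff γ (expCre c₂))
      (Complex.exp (∑' j, t₁ j * c₂ j) * MvPowerSeries.coeff β (expCre (c₁ + c₂))) := by
  induction β using state_induction with
  | h0 =>
    simp only [expEntry_zero, prod_pow_mul_coeff_expCre, coeff_expCre_zero, mul_one]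
    exact hasSum_expCre _ h
  | h1 β j ih =>
    have hne : (β j + 1 : ℂ) ≠ 0 := by exact_mod_cast Nat.succ_ne_zero (β j)
    rw [← hasSum_mul_left_iff hne]
    -- The derivative kills the states with `γ j = 0`; the others are reindexed by adding one
    -- quantum in mode `j`.
    have h2 : HasSum (fun γ => expEntry c₁ t₁ β (pderiv j (monomial γ 1)) *
        MvPowerSeries.coeff γ (expCre c₂))
        (c₂ j * (Complex.exp (∑' j, t₁ j * c₂ j) * MvPowerSeries.coeff β (expCre (c₁ + c₂)))) := by
      rw [← (add_single_injective j).hasSum_iff]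
      · simp only [Function.comp_def, pderiv_monomial_mul_expCre]
        exact ih.mul_left _
      · intro γ hγ
        have : γ j = 0 := by
          by_contra hb
          obtain ⟨γ, rfl⟩ := exists_add_single γ j hb
          exact hγ ⟨γ, rfl⟩
        rw [pderiv_monomial, this]
        simp [expEntry]
    refine hasSum_of_eq ((ih.mul_left (c₁ j)).add h2) (fun γ => ?_) ?_
    · rw [← mul_assoc, expEntry_add_single]
      ring
    · rw [mul_left_comm, coeff_expCre_add, Pi.add_apply]
      ring

/-- Composition of two normally ordered exponentials. -/
theorem hasSum_expEntry_mul (c₁ t₁ c₂ t₂ : Mode → ℂ) (h : Summable fun j => t₁ j * c₂ j)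
    (f : Fock) : ∀ β,
    HasSum (fun γ => expEntry c₁ t₁ β (monomial γ 1) * expEntry c₂ t₂ γ f)
      (Complex.exp (∑' j, t₁ j * c₂ j) * expEntry (c₁ + c₂) (t₁ + t₂) β f) := by
  induction f using MvPolynomial.induction_on with
  | C a =>
    intro β
    simp only [expEntry_C]
    refine hasSum_of_eq ((hasSum_expEntry_mul_expCre c₁ t₁ c₂ h β).mul_left a) (fun γ => ?_) ?_
    · ring
    · ring
  | add f g hf hg =>
    intro β
    simp only [expEntry_add, mul_add]
    exact (hf β).add (hg β)
  | mul_X f j ih =>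
    intro β
    set E := Complex.exp (∑' j, t₁ j * c₂ j)
    -- Subtracting the translation term leaves pure multiplication by `X j`, which reaches only
    -- states with `γ j > 0`. Reindexing moves this `X j` into the column of the left factor, where
    -- it can be expanded.
    have h2 : HasSum (fun γ => expEntry c₁ t₁ β (monomial γ 1) *
        (expEntry c₂ t₂ γ (f * X j) - t₂ j * expEntry c₂ t₂ γ f))
        (E * (expEntry (c₁ + c₂) (t₁ + t₂) β (f * X j) -
          t₂ j * expEntry (c₁ + c₂) (t₁ + t₂) β f)) := by
      rw [← (add_single_injective j).hasSum_iff]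
      · simp only [Function.comp_def, expEntry_mul_X_add, add_sub_cancel_left,
          monomial_add_single_one]
        by_cases hb : β j = 0
        · simp only [expEntry_mul_X_of_eq_zero _ _ _ _ _ hb]
          refine hasSum_of_eq ((ih β).mul_left (t₁ j)) (fun γ => ?_) ?_
          · ring
          · rw [Pi.add_apply]; ring
        · obtain ⟨β, rfl⟩ := exists_add_single β j hb
          simp only [expEntry_mul_X_add]
          refine hasSum_of_eq (((ih (β + Finsupp.single j 1)).mul_left (t₁ j)).add (ih β)) (fun γ => ?_) ?_
          · ring
          · rw [Pi.add_apply]; ring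
      · intro γ hγ
        have : γ j = 0 := by
          by_contra hb
          obtain ⟨γ, rfl⟩ := exists_add_single γ j hb
          exact hγ ⟨γ, rfl⟩
        rw [expEntry_mul_X_of_eq_zero _ _ _ _ _ this, sub_self, mul_zero]
    refine hasSum_of_eq (h2.add ((ih β).mul_left (t₂ j))) (fun γ => ?_) ?_
    · ring
    · ring

/-! ### Products of several normally ordered exponentials on a tensor product -/

/-- The entries of a tensor product of normally ordered exponentials. -/
def tensorEntry {n : ℕ} (c t : Fin n → Mode → ℂ) : Matrix (Fin n → State) (Fin n → State) ℂ :=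
  fun β α => ∏ k, expEntry (c k) (t k) (β k) (monomial (α k) 1)

/-- The scalar produced by normally ordering a product of two exponentials. -/
def contraction {n : ℕ} (t c : Fin n → Mode → ℂ) : ℂ :=
  ∏ k, Complex.exp (∑' j, t k j * c k j)

theorem hasSum_tensorEntry_mul {n : ℕ} (c₁ t₁ c₂ t₂ : Fin n → Mode → ℂ)
    (h : ∀ k, Summable fun j => t₁ k j * c₂ k j) (β α : Fin n → State) :
    HasSum (fun γ => tensorEntry c₁ t₁ β γ * tensorEntry c₂ t₂ γ α)
      (contraction t₁ c₂ * tensorEntry (c₁ + c₂) (t₁ + t₂) β α) := by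
  simp only [tensorEntry, contraction, ← Finset.prod_mul_distrib]
  exact hasSum_prod_fin
    (fun k γ => expEntry (c₁ k) (t₁ k) (β k) (monomial γ 1) *
      expEntry (c₂ k) (t₂ k) γ (monomial (α k) 1)) _
    fun k => hasSum_expEntry_mul (c₁ k) (t₁ k) (c₂ k) (t₂ k) (h k) (monomial (α k) 1) (β k)

theorem tensorEntry_zero {n : ℕ} (β α : Fin n → State) :
    tensorEntry 0 0 β α = if β = α then 1 else 0 := by
  simp only [tensorEntry, Pi.zero_apply, expEntry_zero_zero]
  rw [Finset.prod_ite_zero]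
  simp [funext_iff]

theorem tensorEntry_abs {n : ℕ} (c t : Fin n → Mode → ℂ) (β α : Fin n → State) : ∃ y : ℝ, 0 ≤ y ∧
    tensorEntry (fun k j => (‖c k j‖ : ℂ)) (fun k j => (‖t k j‖ : ℂ)) β α = y ∧
    ‖tensorEntry c t β α‖ ≤ y := by
  choose y h0 h1 h2 using fun k => expEntry_abs (c k) (t k) (α k) (β k)
  refine ⟨∏ k, y k, Finset.prod_nonneg fun k _ => h0 k, ?_, ?_⟩
  · simp [tensorEntry, h1]
  · rw [tensorEntry, norm_prod]
    exact Finset.prod_le_prod (fun _ _ => norm_nonneg _) fun k _ => h2 k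

/-- The sequences of `m` steps from `β` to `α`. -/
abbrev Path {ι : Type} (m : ℕ) (β α : ι) :=
  {γ : Fin (m + 1) → ι // γ 0 = β ∧ γ (Fin.last m) = α}

/-- A path is its first step followed by a path. -/
def pathCons {ι : Type} (m : ℕ) (β α : ι) : (Σ γ₁ : ι, Path m γ₁ α) ≃ Path (m + 1) β α where
  toFun x := ⟨Fin.cons β x.2.1, by simp, by
    rw [← Fin.succ_last, Fin.cons_succ, x.2.2.2]⟩
  invFun γ := ⟨γ.1 1, fun a => γ.1 a.succ, by simp, by simpa using γ.2.2⟩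
  left_inv x := by
    obtain ⟨γ₁, γ, rfl, h⟩ := x
    simp only [Fin.cons_succ]
    congr 1
  right_inv γ := by
    obtain ⟨γ, rfl, h⟩ := γ
    simp only [Subtype.mk.injEq]
    exact Fin.cons_self_tail γ

theorem prod_pathCons {ι : Type} {R : Type*} [CommMonoid R] {m : ℕ} {β α : ι}
    (A : Fin (m + 1) → Matrix ι ι R) (x : Σ γ₁ : ι, Path m γ₁ α) :
    ∏ a, A a ((pathCons m β α x).1 a.castSucc) ((pathCons m β α x).1 a.succ) =
      A 0 β x.1 * ∏ a : Fin m, A a.succ (x.2.1 a.castSucc) (x.2.1 a.succ) := by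
  rw [Fin.prod_univ_succ]
  congr 1
  simp [pathCons, x.2.2.1]

theorem summable_sigma_mul {ι : Type} {P : ι → Type} (b : ι → ℝ) (g : ∀ i, P i → ℝ)
    (hb : ∀ i, 0 ≤ b i) (hg : ∀ i x, 0 ≤ g i x) {w : ι → ℝ} (hw : ∀ i, HasSum (g i) (w i))
    (hW : Summable fun i => b i * w i) : Summable fun x : Σ i, P i => b x.1 * g x.1 x.2 := by
  have h0 : ∀ x : Σ i, P i, 0 ≤ b x.1 * g x.1 x.2 := fun x => mul_nonneg (hb _) (hg _ _)
  have h1 : ∀ i, HasSum (fun x => b i * g i x) (b i * w i) := fun i => (hw i).mul_left (b i)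
  exact (summable_sigma_of_nonneg h0).2
    ⟨fun i => (h1 i).summable, hW.congr fun i => (h1 i).tsum_eq.symm⟩

/-- Iterated sums alone would not give a sum over all paths. The non-negative majorant `B`, whose
iterated sums are finite, makes the family over paths summable, and then the order of summation is
free. -/
theorem hasProductEntry_cons {ι : Type} {m : ℕ} {β α : ι} {A : Fin (m + 1) → Matrix ι ι ℂ}
    {v : ι → ℂ} {V : ℂ} (hv : ∀ γ, HasProductEntry (fun a => A a.succ) γ α (v γ))
    (hV : HasSum (fun γ => A 0 β γ * v γ) V) {B : Fin (m + 1) → Matrix ι ι ℝ} {w : ι → ℝ}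
    (hB : ∀ a β α, 0 ≤ B a β α) (hAB : ∀ a β α, ‖A a β α‖ ≤ B a β α)
    (hw : ∀ γ, HasSum (fun x : Path m γ α => ∏ a : Fin m, B a.succ (x.1 a.castSucc) (x.1 a.succ))
      (w γ)) (hW : Summable fun γ => B 0 β γ * w γ) :
    HasProductEntry A β α V := by
  rw [HasProductEntry, ← (pathCons m β α).hasSum_iff]
  simp only [Function.comp_def, prod_pathCons]
  have hsB : Summable fun x : Σ γ₁ : ι, Path m γ₁ α =>
      B 0 β x.1 * ∏ a : Fin m, B a.succ (x.2.1 a.castSucc) (x.2.1 a.succ) :=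
    summable_sigma_mul (fun γ => B 0 β γ)
      (fun (γ : ι) (x : Path m γ α) => ∏ a : Fin m, B a.succ (x.1 a.castSucc) (x.1 a.succ))
      (fun _ => hB _ _ _) (fun _ _ => Finset.prod_nonneg fun _ _ => hB _ _ _) hw hW
  have hsA : Summable fun x : Σ γ₁ : ι, Path m γ₁ α =>
      A 0 β x.1 * ∏ a : Fin m, A a.succ (x.2.1 a.castSucc) (x.2.1 a.succ) := by
    refine hsB.of_norm_bounded fun x => ?_
    rw [norm_mul, norm_prod]
    exact mul_le_mul (hAB _ _ _)
      (Finset.prod_le_prod (fun _ _ => norm_nonneg _) fun _ _ => hAB _ _ _)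
      (Finset.prod_nonneg fun _ _ => norm_nonneg _) (hB _ _ _)
  have h1 := hsA.hasSum.sigma fun γ => (hv γ).mul_left (A 0 β γ)
  rw [hV.unique h1]
  exact hsA.hasSum

theorem contraction_sum {n m : ℕ} (t : Fin n → Mode → ℂ) (c : Fin m → Fin n → Mode → ℂ)
    (h : ∀ b k, Summable fun j => t k j * c b k j) :
    contraction t (∑ b, c b) = ∏ b, contraction t (c b) := by
  simp only [contraction]
  rw [Finset.prod_comm]
  refine Finset.prod_congr rfl fun k _ => ?_
  rw [← Complex.exp_sum, ← Summable.tsum_finsetSum fun b _ => h b k]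
  simp [Finset.mul_sum]

theorem hasProductEntry_tensorEntry {n m : ℕ} (c t : Fin m → Fin n → Mode → ℂ)
    (h : ∀ a b, a < b → ∀ k, Summable fun j => t a k j * c b k j) (β α : Fin n → State) :
    HasProductEntry (fun a => tensorEntry (c a) (t a)) β α
      ((∏ a, ∏ b, if a < b then contraction (t a) (c b) else 1) *
        tensorEntry (∑ a, c a) (∑ a, t a) β α) := by
  induction m generalizing β with
  | zero =>
    simp only [Finset.univ_eq_empty, Finset.prod_empty, Finset.sum_empty, one_mul,
      tensorEntry_zero, HasProductEntry]
    split_ifs with hb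
    · subst hb
      have : Unique (Path 0 β β) := ⟨⟨⟨fun _ => β, rfl, rfl⟩⟩, fun x => Subtype.ext (funext fun a => by
        obtain rfl : a = 0 := Fin.fin_one_eq_zero a; exact x.2.1)⟩
      exact hasSum_unique (fun _ : Path 0 β β => (1 : ℂ))
    · have : IsEmpty (Path 0 β α) := ⟨fun x => hb (x.2.1.symm.trans x.2.2)⟩
      exact hasSum_empty
  | succ m ih =>
    have ih₁ := fun γ => ih (fun a => c a.succ) (fun a => t a.succ)
      (fun a b hab => h _ _ (Fin.succ_lt_succ_iff.2 hab)) γ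
    set c' : Fin (m + 1) → Fin n → Mode → ℂ := fun a k j => (‖c a k j‖ : ℂ) with hc'
    set t' : Fin (m + 1) → Fin n → Mode → ℂ := fun a k j => (‖t a k j‖ : ℂ) with ht'
    have h' : ∀ a b, a < b → ∀ k, Summable fun j => t' a k j * c' b k j := by
      intro a b hab k
      have := (h a b hab k).norm
      simp only [norm_mul] at this
      simp only [hc', ht', ← Complex.ofReal_mul]
      exact Complex.summable_ofReal.2 this
    -- The induction hypothesis is used twice: for the given exponents to obtain the value, and for
    -- their norms to obtain the finite sums of the majorant. These sums are real, and `.re` below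
    -- extracts them.
    have ih₂ := fun γ => ih (fun a => c' a.succ) (fun a => t' a.succ)
      (fun a b hab => h' _ _ (Fin.succ_lt_succ_iff.2 hab)) γ
    choose B hB0 hB1 hB2 using fun a => tensorEntry_abs (c a) (t a)
    have hsum : ∀ (c t : Fin (m + 1) → Fin n → Mode → ℂ),
        (∀ a b, a < b → ∀ k, Summable fun j => t a k j * c b k j) → ∀ k,
        Summable fun j => t 0 k j * (∑ b : Fin m, c b.succ) k j := by
      intro c t h k
      simp only [Finset.sum_apply, Finset.mul_sum]
      exact summable_sum fun b _ => h 0 b.succ (Fin.succ_pos b) k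
    refine hasProductEntry_cons (B := B) ih₁ ?_ hB0 hB2
      (w := fun γ => ((∏ a : Fin m, ∏ b : Fin m,
        if a < b then contraction (t' a.succ) (c' b.succ) else 1) *
        tensorEntry (∑ a : Fin m, c' a.succ) (∑ a : Fin m, t' a.succ) γ α).re) ?_ ?_
    · refine hasSum_of_eq ((hasSum_tensorEntry_mul (c 0) (t 0) _ _ (hsum c t h) β α).mul_left
        (∏ a : Fin m, ∏ b : Fin m, if a < b then contraction (t a.succ) (c b.succ) else 1))
        (fun γ => by ring) ?_
      rw [contraction_sum _ _ fun b k => h _ _ (Fin.succ_pos b) k, Fin.prod_univ_succ,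
        Fin.sum_univ_succ c, Fin.sum_univ_succ t]
      simp only [Fin.prod_univ_succ (n := m), Fin.succ_lt_succ_iff, Fin.succ_pos, lt_irrefl,
        if_true, if_false, Fin.not_lt_zero, one_mul]
      ring
    · intro γ
      refine (Complex.hasSum_re (ih₂ γ)).congr_fun fun x => ?_
      rw [← Complex.ofReal_re (∏ a : Fin m, _)]
      congr 1
      push_cast
      exact Finset.prod_congr rfl fun a _ => (hB1 _ _ _).symm
    · have := Complex.hasSum_re ((hasSum_tensorEntry_mul (c' 0) (t' 0) _
        (∑ a : Fin m, t' a.succ) (hsum c' t' h') β α).mul_left (∏ a : Fin m, ∏ b : Fin m,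
        if a < b then contraction (t' a.succ) (c' b.succ) else 1))
      refine this.summable.congr fun γ => ?_
      rw [mul_left_comm, hB1, Complex.re_ofReal_mul]

/-! ### The theta function -/

theorem one_sub_pow_ne_zero {p : ℂ} (hp : ‖p‖ < 1) (n : ℕ+) : 1 - p ^ (n : ℕ) ≠ 0 := by
  intro h
  have h1 : ‖p ^ (n : ℕ)‖ = 1 := by rw [← sub_eq_zero.1 h, norm_one]
  rw [norm_pow] at h1
  exact (pow_lt_one₀ (norm_nonneg _) hp n.ne_zero).ne h1

theorem multipliable_qPoch (x : ℂ) {p : ℂ} (hp : ‖p‖ < 1) :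
    Multipliable fun k : ℕ => 1 - p ^ k * x := by
  have h : Summable fun k : ℕ => ‖-(p ^ k * x)‖ := by
    simp only [norm_neg, norm_mul, norm_pow]
    exact (summable_geometric_of_lt_one (norm_nonneg _) hp).mul_right _
  simpa [sub_eq_add_neg] using multipliable_one_add_of_summable h

theorem qPoch_eq_mul (x : ℂ) {p : ℂ} (hp : ‖p‖ < 1) :
    qPoch x p = (1 - x) * qPoch (p * x) p := by
  have h : (fun k : ℕ => 1 - p ^ (k + 1) * x) = fun k : ℕ => 1 - p ^ k * (p * x) := by
    funext k; ring
  have h1 : Multipliable fun k : ℕ => 1 - p ^ (k + 1) * x := by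
    rw [h]; exact multipliable_qPoch (p * x) hp
  have h2 := tprod_eq_zero_mul' (f := fun k : ℕ => 1 - p ^ k * x) h1
  rw [h, pow_zero, one_mul] at h2
  exact h2

theorem qPoch_eq_prod_mul (x : ℂ) {p : ℂ} (hp : ‖p‖ < 1) (K : ℕ) :
    qPoch x p = (∏ k ∈ Finset.range K, (1 - p ^ k * x)) * qPoch (p ^ K * x) p := by
  induction K with
  | zero => simp
  | succ K ih =>
    rw [ih, qPoch_eq_mul _ hp, Finset.prod_range_succ, pow_succ']
    ring_nf

/-- Both statements evaluate the double series of `p^(kn) x^n / n`: summed over `n` first it gives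
the logarithms of the factors, summed over `k` first the geometric series gives `1 / (1 - p^n)`. -/
theorem exists_log_qPoch {x p : ℂ} (hx : ‖x‖ < 1) (hp : ‖p‖ < 1) :
    ∃ S, HasSum (fun n : ℕ+ => x ^ (n : ℕ) / (n : ℕ) / (1 - p ^ (n : ℕ))) S ∧
      Complex.exp (-S) = qPoch x p := by
  let G : ℕ × ℕ+ → ℂ := fun a => (p ^ a.1 * x) ^ (a.2 : ℕ) / (a.2 : ℕ)
  have hG : Summable G := by
    have h1 : Summable fun k : ℕ => ‖p‖ ^ k := summable_geometric_of_lt_one (norm_nonneg _) hp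
    have h2 : Summable fun n : ℕ+ => ‖x‖ ^ (n : ℕ) :=
      (summable_geometric_of_lt_one (norm_nonneg _) hx).comp_injective PNat.coe_injective
    have h3 : Summable fun a : ℕ × ℕ+ => ‖p‖ ^ a.1 * ‖x‖ ^ (a.2 : ℕ) :=
      h1.mul_of_nonneg h2 (fun _ => by positivity) fun _ => by positivity
    refine h3.of_norm_bounded fun a => ?_
    simp only [G, norm_div, norm_pow, norm_mul, mul_pow, Complex.norm_natCast]
    have hn : (1 : ℝ) ≤ (a.2 : ℕ) := by exact_mod_cast a.2.pos
    refine (div_le_self (by positivity) hn).trans ?_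
    gcongr
    rw [← pow_mul]
    exact pow_le_pow_of_le_one (norm_nonneg _) hp.le (Nat.le_mul_of_pos_right _ a.2.pos)
  have hk : ∀ k : ℕ, HasSum (fun n : ℕ+ => G (k, n)) (-Complex.log (1 - p ^ k * x)) := by
    intro k
    have hlt : ‖p ^ k * x‖ < 1 := by
      rw [norm_mul, norm_pow]
      exact (mul_le_of_le_one_left (norm_nonneg _) (pow_le_one₀ (norm_nonneg _) hp.le)).trans_lt hx
    have h := Complex.hasSum_taylorSeries_neg_log hlt
    rw [← PNat.coe_injective.hasSum_iff] at h
    · exact h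
    · intro n hn
      have : n = 0 := by
        by_contra h0
        exact hn ⟨⟨n, Nat.pos_of_ne_zero h0⟩, rfl⟩
      simp [this]
  have hn : ∀ n : ℕ+, HasSum (fun k : ℕ => G (k, n)) (x ^ (n : ℕ) / (n : ℕ) / (1 - p ^ (n : ℕ))) := by
    intro n
    have hlt : ‖p ^ (n : ℕ)‖ < 1 := by
      rw [norm_pow]; exact pow_lt_one₀ (norm_nonneg _) hp n.ne_zero
    refine hasSum_of_eq ((hasSum_geometric_of_norm_lt_one hlt).mul_left (x ^ (n : ℕ) / (n : ℕ)))
      (fun k => ?_) (div_eq_mul_inv _ _)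
    simp only [G]
    rw [mul_pow, ← pow_mul, ← pow_mul, mul_comm k]
    ring
  have h1 : HasSum (fun k : ℕ => -Complex.log (1 - p ^ k * x)) (∑' a, G a) :=
    hG.hasSum.prod_fiberwise hk
  have h2 : HasSum (fun n : ℕ+ => x ^ (n : ℕ) / (n : ℕ) / (1 - p ^ (n : ℕ))) (∑' a, G a) :=
    ((Equiv.prodComm _ _).hasSum_iff.2 hG.hasSum).prod_fiberwise hn
  refine ⟨_, h2, ?_⟩
  have h3 := h1.neg.cexp
  rw [qPoch, ← h3.tprod_eq]
  refine tprod_congr fun k => ?_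
  simp only [Function.comp, neg_neg]
  rw [Complex.exp_log]
  intro h0
  have : ‖p ^ k * x‖ = 1 := by rw [← sub_eq_zero.1 h0, norm_one]
  rw [norm_mul, norm_pow] at this
  exact ((mul_le_of_le_one_left (norm_nonneg _) (pow_le_one₀ (norm_nonneg _) hp.le)).trans_lt
    hx).ne this

theorem qPoch_ne_zero {x p : ℂ} (hx : ‖x‖ < 1) (hp : ‖p‖ < 1) : qPoch x p ≠ 0 := by
  obtain ⟨S, _, h⟩ := exists_log_qPoch hx hp
  rw [← h]
  exact Complex.exp_ne_zero _

theorem theta_one {p : ℂ} (hp : ‖p‖ < 1) : theta p 1 = 0 := by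
  rw [theta, qPoch_eq_mul _ hp]
  simp

theorem theta_inv {p x : ℂ} (hp : ‖p‖ < 1) (hx : x ≠ 0) : theta p x⁻¹ = -x⁻¹ * theta p x := by
  rw [theta, theta, inv_inv, qPoch_eq_mul x⁻¹ hp, qPoch_eq_mul x hp]
  field_simp
  ring

/-- The coefficients of `-log θ_p(y)`, sorted by modes. -/
def logTheta (p y : ℂ) : Mode → ℂ
  | Sum.inl n => y ^ (n : ℕ) / (n : ℕ) / (1 - p ^ (n : ℕ))
  | Sum.inr n => (p * y⁻¹) ^ (n : ℕ) / (n : ℕ) / (1 - p ^ (n : ℕ))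

/-- The `a`-modes produce `(y; p)_∞` and the `b`-modes `(p / y; p)_∞`. Both series converge exactly
on the annulus `‖p‖ < ‖y‖ < 1` used here, which is why widely separated arguments are needed. -/
theorem exists_hasSum_logTheta {p y : ℂ} (hp : ‖p‖ < 1) (hy : ‖y‖ < 1) (hpy : ‖p * y⁻¹‖ < 1) :
    ∃ S, HasSum (logTheta p y) S ∧ Complex.exp (-S) = theta p y := by
  obtain ⟨S, hS, h1⟩ := exists_log_qPoch hy hp
  obtain ⟨T, hT, h2⟩ := exists_log_qPoch hpy hp
  refine ⟨S + T, HasSum.sum (f := logTheta p y) hS hT, ?_⟩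
  rw [neg_add, Complex.exp_add, h1, h2, theta]

/-! ### Joint holomorphy of the theta function in the nome and the argument. -/

theorem differentiableOn_log_qPoch {ρ : ℝ} (h0 : 0 < ρ) (h1 : ρ < 1) :
    DifferentiableOn ℂ (fun x : ℂ × ℂ => ∑' n : ℕ+, x.2 ^ (n : ℕ) / (n : ℕ) / (1 - x.1 ^ (n : ℕ)))
      (Metric.ball 0 ρ ×ˢ Metric.ball 0 (1 / 2)) := by
  have hden : ∀ (p : ℂ), ‖p‖ < ρ → ∀ n : ℕ+, (1 - ρ) ≤ ‖1 - p ^ (n : ℕ)‖ := by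
    intro p hp n
    have : ‖p ^ (n : ℕ)‖ ≤ ρ := by
      rw [norm_pow]
      exact (pow_le_of_le_one (norm_nonneg _) (hp.le.trans h1.le) n.ne_zero).trans hp.le
    have h2 := norm_sub_norm_le (1 : ℂ) (p ^ (n : ℕ))
    rw [norm_one] at h2
    linarith
  have hρ : 0 < 1 - ρ := by linarith
  intro x hx
  -- The two summands bound the partial derivatives in the nome and in the argument; the `2`
  -- compensates for the exponent `n - 1` of the argument.
  have hu : Summable fun n : ℕ+ => (1 / 2 : ℝ) ^ (n : ℕ) * (1 / (1 - ρ) ^ 2 + 2 / (1 - ρ)) :=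
    ((summable_geometric_of_lt_one (by norm_num) (by norm_num)).comp_injective
      PNat.coe_injective).mul_right _
  let f' : ℕ+ → ℂ × ℂ → (ℂ × ℂ →L[ℂ] ℂ) := fun n x =>
    (x.2 ^ (n : ℕ) * x.1 ^ ((n : ℕ) - 1) / (1 - x.1 ^ (n : ℕ)) ^ 2) •
        ContinuousLinearMap.fst ℂ ℂ ℂ +
      (x.2 ^ ((n : ℕ) - 1) / (1 - x.1 ^ (n : ℕ))) • ContinuousLinearMap.snd ℂ ℂ ℂ
  refine (hasFDerivAt_tsum_of_isPreconnected (𝕜 := ℂ) hu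
    (Metric.isOpen_ball.prod Metric.isOpen_ball)
    (((convex_ball _ _).prod (convex_ball _ _)).isPreconnected) (f' := f') (x₀ := (0, 0))
    ?_ ?_ ?_ ?_ hx).differentiableAt.differentiableWithinAt
  · intro n x hx
    obtain ⟨hx1, hx2⟩ := hx
    rw [mem_ball_zero_iff] at hx1 hx2
    have hd : 1 - x.1 ^ (n : ℕ) ≠ 0 := norm_pos_iff.1 (hρ.trans_le (hden _ hx1 n))
    have hn : ((n : ℕ) : ℂ) ≠ 0 := by exact_mod_cast n.ne_zero
    have e1 : HasFDerivAt (fun x : ℂ × ℂ => x.2 ^ (n : ℕ))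
        (((n : ℕ) * x.2 ^ ((n : ℕ) - 1)) • ContinuousLinearMap.snd ℂ ℂ ℂ) x :=
      (hasDerivAt_pow (n : ℕ) x.2).comp_hasFDerivAt x hasFDerivAt_snd
    have e2 : HasFDerivAt (fun x : ℂ × ℂ => (1 - x.1 ^ (n : ℕ))⁻¹)
        ((-(-((n : ℕ) * x.1 ^ ((n : ℕ) - 1))) / (1 - x.1 ^ (n : ℕ)) ^ 2) •
          ContinuousLinearMap.fst ℂ ℂ ℂ) x :=
      (((hasDerivAt_pow (n : ℕ) x.1).const_sub 1).inv hd).comp_hasFDerivAt x hasFDerivAt_fst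
    refine ((e1.mul e2).mul_const ((n : ℕ) : ℂ)⁻¹).congr_fderiv ?_ |>.congr_of_eventuallyEq ?_
    · ext <;> simp [f'] <;> field_simp
    · exact Filter.Eventually.of_forall fun y => by simp only [Pi.mul_apply]; ring
  · intro n x hx
    obtain ⟨hx1, hx2⟩ := hx
    rw [mem_ball_zero_iff] at hx1 hx2
    have hd := hden _ hx1 n
    have b1 : ‖x.2‖ ^ (n : ℕ) ≤ (1 / 2) ^ (n : ℕ) := by gcongr
    have b2 : ‖x.2‖ ^ ((n : ℕ) - 1) ≤ (1 / 2) ^ (n : ℕ) * 2 := by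
      obtain ⟨k, hk⟩ : ∃ k, (n : ℕ) = k + 1 := ⟨(n : ℕ) - 1, by have := n.pos; omega⟩
      rw [hk, Nat.add_sub_cancel, pow_succ, mul_assoc]
      have : ‖x.2‖ ≤ 1 / 2 := hx2.le
      calc ‖x.2‖ ^ k ≤ (1 / 2) ^ k := by gcongr
        _ = (1 / 2) ^ k * (1 / 2 * 2) := by norm_num
    have b3 : ‖x.1‖ ^ ((n : ℕ) - 1) ≤ 1 := pow_le_one₀ (norm_nonneg _) (hx1.trans h1).le
    calc ‖f' n x‖ ≤ ‖x.2 ^ (n : ℕ) * x.1 ^ ((n : ℕ) - 1) / (1 - x.1 ^ (n : ℕ)) ^ 2‖ * 1 +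
          ‖x.2 ^ ((n : ℕ) - 1) / (1 - x.1 ^ (n : ℕ))‖ * 1 := by
          refine (norm_add_le _ _).trans ?_
          rw [norm_smul, norm_smul]
          gcongr
          · exact ContinuousLinearMap.norm_fst_le _ _ _
          · exact ContinuousLinearMap.norm_snd_le _ _ _
      _ ≤ (1 / 2) ^ (n : ℕ) * 1 / (1 - ρ) ^ 2 * 1 + (1 / 2) ^ (n : ℕ) * 2 / (1 - ρ) * 1 := by
          simp only [norm_div, norm_mul, norm_pow]
          gcongr
      _ = _ := by ring
  · simp [h0]
  · exact summable_zero.congr fun n => by simp [n.ne_zero]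

theorem differentiableOn_prod {ι E : Type*} [NormedAddCommGroup E] [NormedSpace ℂ E] {s : Set E}
    (t : Finset ι) {f : ι → E → ℂ} (h : ∀ i ∈ t, DifferentiableOn ℂ (f i) s) :
    DifferentiableOn ℂ (fun x => ∏ i ∈ t, f i x) s := by
  classical
  induction t using Finset.induction_on with
  | empty => simp
  | insert i t hi ih =>
    simp only [Finset.prod_insert hi]
    exact (h i (Finset.mem_insert_self _ _)).mul
      (ih fun j hj => h j (Finset.mem_insert_of_mem hj))

/-- Splitting off `K` factors replaces the argument by `p ^ K * y`, which is small uniformly near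
the given point, so the rest is the exponential of a holomorphic series. -/
theorem differentiableAt_qPoch {p y : ℂ} (hp : ‖p‖ < 1) :
    DifferentiableAt ℂ (fun x : ℂ × ℂ => qPoch x.2 x.1) (p, y) := by
  obtain ⟨ρ, hpρ, hρ1⟩ := exists_between hp
  have hρ0 : 0 < ρ := (norm_nonneg _).trans_lt hpρ
  obtain ⟨K, hK⟩ : ∃ K : ℕ, ρ ^ K * (‖y‖ + 1) < 1 / 2 := by
    have h : Filter.Tendsto (fun K : ℕ => ρ ^ K * (‖y‖ + 1)) Filter.atTop (nhds (0 * (‖y‖ + 1))) :=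
      (tendsto_pow_atTop_nhds_zero_of_lt_one hρ0.le hρ1).mul_const _
    rw [zero_mul] at h
    exact (h.eventually_lt_const (by norm_num : (0 : ℝ) < 1 / 2)).exists
  set s : Set (ℂ × ℂ) := Metric.ball 0 ρ ×ˢ Metric.ball 0 (‖y‖ + 1)
  have hs : s ∈ nhds (p, y) := (Metric.isOpen_ball.prod Metric.isOpen_ball).mem_nhds
    ⟨by simpa using hpρ, by simp⟩
  have hmaps : ∀ x ∈ s, (x.1, x.1 ^ K * x.2) ∈
      Metric.ball (0 : ℂ) ρ ×ˢ Metric.ball (0 : ℂ) (1 / 2) := by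
    rintro x ⟨h1, h2⟩
    refine ⟨h1, ?_⟩
    rw [mem_ball_zero_iff] at h1 h2 ⊢
    refine lt_of_le_of_lt ?_ hK
    rw [norm_mul, norm_pow]
    gcongr
  have hd : DifferentiableOn ℂ (fun x : ℂ × ℂ => (∏ k ∈ Finset.range K, (1 - x.1 ^ k * x.2)) *
      Complex.exp (-∑' n : ℕ+, (x.1 ^ K * x.2) ^ (n : ℕ) / (n : ℕ) / (1 - x.1 ^ (n : ℕ)))) s := by
    refine DifferentiableOn.mul
      (differentiableOn_prod _ fun k _ => by fun_prop) (DifferentiableOn.cexp (DifferentiableOn.neg ?_))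
    exact (differentiableOn_log_qPoch hρ0 hρ1).comp
      (f := fun x : ℂ × ℂ => (x.1, x.1 ^ K * x.2)) (by fun_prop) hmaps
  refine (hd.differentiableAt hs).congr_of_eventuallyEq ?_
  filter_upwards [hs] with x hx
  obtain ⟨h1, h2⟩ := hmaps x hx
  rw [mem_ball_zero_iff] at h1 h2
  obtain ⟨S, hS, hS'⟩ := exists_log_qPoch (h2.trans (by norm_num)) (h1.trans hρ1)
  rw [qPoch_eq_prod_mul _ (h1.trans hρ1) K, ← hS', ← hS.tsum_eq]

theorem DifferentiableOn.theta {E : Type*} [NormedAddCommGroup E] [NormedSpace ℂ E] {s : Set E}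
    {f g : E → ℂ} (hf : DifferentiableOn ℂ f s) (hg : DifferentiableOn ℂ g s)
    (hf1 : ∀ x ∈ s, ‖f x‖ < 1) (hg0 : ∀ x ∈ s, g x ≠ 0) :
    DifferentiableOn ℂ (fun x => theta (f x) (g x)) s := by
  intro x hx
  have h1 : DifferentiableWithinAt ℂ (fun x => qPoch (g x) (f x)) s x :=
    (differentiableAt_qPoch (y := g x) (hf1 x hx)).comp_differentiableWithinAt x
      (f := fun x => (f x, g x)) ((hf x hx).prodMk (hg x hx))
  have h2 : DifferentiableWithinAt ℂ (fun x => qPoch (f x * (g x)⁻¹) (f x)) s x :=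
    (differentiableAt_qPoch (y := f x * (g x)⁻¹) (hf1 x hx)).comp_differentiableWithinAt x
      (f := fun x => (f x, f x * (g x)⁻¹))
      ((hf x hx).prodMk ((hf x hx).mul ((hg x hx).inv (hg0 x hx))))
  exact h1.mul h2

/-! ### The tensor product representation -/

/-- The exponents of the vertex operator `Λ_j(z)`. -/
def vertexExp (r : Fin 3 → ℂ) (p : ℂ) {n : ℕ} (c : Fin n → Fin 3) (j : Fin n) (z : ℂ) :
    Fin n → Exponent := fun k =>
  if k < j then phiExp r p (c k) ((∏ i ∈ Finset.Iic k, qh r (c i)) * z)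
  else if k = j then etaExp r p (c k) ((∏ i ∈ Finset.Iio k, qh r (c i)) * z)
  else 0

theorem expOp_zero (comm : Mode → ℂ) (β α : State) :
    expOp comm 0 β α = (1 : Matrix State State ℂ) β α := by
  rw [expOp_eq, Matrix.one_apply, ← expEntry_zero_zero]
  congr
  funext j
  simp

theorem prod_Iic_castSucc {n : ℕ} (f : Fin (n + 1) → ℂ) (k : Fin n) :
    ∏ i ∈ Finset.Iic k.castSucc, f i = ∏ i ∈ Finset.Iic k, f i.castSucc := by
  rw [← Fin.map_castSuccEmb_Iic, Finset.prod_map]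
  rfl

theorem prod_Iio_castSucc {n : ℕ} (f : Fin (n + 1) → ℂ) (k : Fin n) :
    ∏ i ∈ Finset.Iio k.castSucc, f i = ∏ i ∈ Finset.Iio k, f i.castSucc := by
  rw [← Fin.map_castSuccEmb_Iio, Finset.prod_map]
  rfl

theorem prod_Iio_last {n : ℕ} (f : Fin (n + 1) → ℂ) :
    ∏ i ∈ Finset.Iio (Fin.last n), f i = ∏ i : Fin n, f i.castSucc := by
  rw [← Finset.filter_gt_eq_Iio, Finset.prod_filter, Fin.prod_univ_castSucc]
  simp [Fin.castSucc_lt_last]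

theorem prod_Ioi_castSucc {n : ℕ} (f : Fin (n + 1) → ℂ) (k : Fin n) :
    ∏ i ∈ Finset.Ioi k.castSucc, f i = (∏ i ∈ Finset.Ioi k, f i.castSucc) * f (Fin.last n) := by
  rw [← Finset.filter_lt_eq_Ioi, ← Finset.filter_lt_eq_Ioi, Finset.prod_filter, Finset.prod_filter,
    Fin.prod_univ_castSucc]
  simp [Fin.castSucc_lt_last]

theorem tensorRep_Km_succ (r : Fin 3 → ℂ) (p : ℂ) {n : ℕ} (c : Fin (n + 1) → Fin 3)
    (u : Fin (n + 1) → ℂ) (z : ℂ) (β α : Fin (n + 1) → State) :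
    (tensorRep r p (n + 1) c u).Km z β α =
      (tensorRep r p n (Fin.init c) (Fin.init u)).Km ((qh r (c (Fin.last n)))⁻¹ * z)
        (Fin.init β) (Fin.init α) *
      expOp (heisComm r p (c (Fin.last n))) (phiExp r p (c (Fin.last n)) z)
        (β (Fin.last n)) (α (Fin.last n)) := rfl

theorem tensorRep_E_succ (r : Fin 3 → ℂ) (p : ℂ) {n : ℕ} (c : Fin (n + 1) → Fin 3)
    (u : Fin (n + 1) → ℂ) (z : ℂ) (β α : Fin (n + 1) → State) :
    (tensorRep r p (n + 1) c u).E z β α =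
      (tensorRep r p n (Fin.init c) (Fin.init u)).E z (Fin.init β) (Fin.init α) *
        (1 : Matrix State State ℂ) (β (Fin.last n)) (α (Fin.last n)) +
      (tensorRep r p n (Fin.init c) (Fin.init u)).Km
        ((tensorRep r p n (Fin.init c) (Fin.init u)).C * z) (Fin.init β) (Fin.init α) *
      (u (Fin.last n) * dTilde₁ r p (c (Fin.last n)) *
        expOp (heisComm r p (c (Fin.last n))) (etaExp r p (c (Fin.last n))
          ((tensorRep r p n (Fin.init c) (Fin.init u)).C * z))
          (β (Fin.last n)) (α (Fin.last n))) := rfl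

theorem tensorRep_C (r : Fin 3 → ℂ) (p : ℂ) {n : ℕ} (c : Fin n → Fin 3) (u : Fin n → ℂ) :
    (tensorRep r p n c u).C = ∏ i, qh r (c i) := by
  induction n with
  | zero => simp [tensorRep, Currents.trivial]
  | succ n ih =>
    rw [Fin.prod_univ_castSucc]
    simp only [tensorRep, Currents.relabel, Currents.tensor, ih, fockRep]
    rfl

theorem tensorRep_Km (r : Fin 3 → ℂ) (p : ℂ) {n : ℕ} (c : Fin n → Fin 3) (u : Fin n → ℂ) (z : ℂ)
    (β α : Fin n → State) :
    (tensorRep r p n c u).Km z β α = ∏ k, expOp (heisComm r p (c k))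
      (phiExp r p (c k) ((∏ i ∈ Finset.Ioi k, qh r (c i))⁻¹ * z)) (β k) (α k) := by
  induction n generalizing z with
  | zero => simp [tensorRep, Currents.trivial, Subsingleton.elim β α]
  | succ n ih =>
    rw [Fin.prod_univ_castSucc, tensorRep_Km_succ, ih,
      show Finset.Ioi (Fin.last n) = ∅ from Finset.Ioi_top, Finset.prod_empty, inv_one, one_mul]
    simp only [prod_Ioi_castSucc, mul_inv, mul_assoc, Fin.init]

theorem tensorRep_E (r : Fin 3 → ℂ) (hr : ∀ i, r i ≠ 0) (p : ℂ) {n : ℕ} (c : Fin n → Fin 3)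
    (u : Fin n → ℂ) (z : ℂ) (β α : Fin n → State) :
    (tensorRep r p n c u).E z β α = ∑ j, u j * dTilde₁ r p (c j) *
      ∏ k, expOp (heisComm r p (c k)) (vertexExp r p c j z k) (β k) (α k) := by
  induction n with
  | zero => simp [tensorRep, Currents.trivial]
  | succ n ih =>
    have hqh : ∀ i, qh r i ≠ 0 := fun i => pow_ne_zero 2 (hr i)
    rw [Fin.sum_univ_castSucc, tensorRep_E_succ, ih, tensorRep_Km, tensorRep_C, Finset.sum_mul]
    have h1 : ∀ j : Fin n, u j.castSucc * dTilde₁ r p (c j.castSucc) *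
        ∏ k, expOp (heisComm r p (c k)) (vertexExp r p c j.castSucc z k) (β k) (α k) =
        Fin.init u j * dTilde₁ r p (Fin.init c j) * (∏ k, expOp (heisComm r p (Fin.init c k))
          (vertexExp r p (Fin.init c) j z k) (Fin.init β k) (Fin.init α k)) *
          (1 : Matrix State State ℂ) (β (Fin.last n)) (α (Fin.last n)) := by
      intro j
      have hl : vertexExp r p c j.castSucc z (Fin.last n) = 0 := by
        rw [vertexExp, if_neg (Fin.castSucc_lt_last j).not_gt, if_neg (Fin.castSucc_lt_last j).ne']
      have hk : ∀ k : Fin n, vertexExp r p c j.castSucc z k.castSucc =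
          vertexExp r p (Fin.init c) j z k := by
        intro k
        simp only [vertexExp, Fin.castSucc_lt_castSucc_iff, Fin.castSucc_inj, prod_Iic_castSucc,
          prod_Iio_castSucc, Fin.init]
      rw [Fin.prod_univ_castSucc, hl, expOp_zero]
      simp only [hk, Fin.init, mul_assoc]
    have h2 : u (Fin.last n) * dTilde₁ r p (c (Fin.last n)) *
        ∏ k, expOp (heisComm r p (c k)) (vertexExp r p c (Fin.last n) z k) (β k) (α k) =
        (∏ k, expOp (heisComm r p (Fin.init c k)) (phiExp r p (Fin.init c k)
          ((∏ i ∈ Finset.Ioi k, qh r (Fin.init c i))⁻¹ * ((∏ i, qh r (Fin.init c i)) * z)))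
          (Fin.init β k) (Fin.init α k)) *
        (u (Fin.last n) * dTilde₁ r p (c (Fin.last n)) *
          expOp (heisComm r p (c (Fin.last n))) (etaExp r p (c (Fin.last n))
            ((∏ i, qh r (Fin.init c i)) * z)) (β (Fin.last n)) (α (Fin.last n))) := by
      have hl : vertexExp r p c (Fin.last n) z (Fin.last n) =
          etaExp r p (c (Fin.last n)) ((∏ i, qh r (Fin.init c i)) * z) := by
        rw [vertexExp, if_neg (lt_irrefl _), if_pos rfl, prod_Iio_last]
        simp only [Fin.init]
      have hk : ∀ k : Fin n, vertexExp r p c (Fin.last n) z k.castSucc =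
          phiExp r p (Fin.init c k)
          ((∏ i ∈ Finset.Ioi k, qh r (Fin.init c i))⁻¹ * ((∏ i, qh r (Fin.init c i)) * z)) := by
        intro k
        -- The coproduct of `K⁻` divides by the central charges to the right of site `k`, while `E`
        -- is evaluated at the total charge. What remains is the product over sites up to and
        -- including `k`, as in `Λ_j`.
        have h : ∏ i, qh r (Fin.init c i) = (∏ i ∈ Finset.Ioi k, qh r (Fin.init c i)) *
            ∏ i ∈ Finset.Iic k, qh r (Fin.init c i) := by
          rw [← Finset.prod_union]
          · congr 1
            ext i
            simp [lt_or_ge]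
          · rw [Finset.disjoint_left]
            intro i h1 h2
            simp at h1 h2
            exact absurd h1 h2.not_gt
        rw [vertexExp, if_pos (Fin.castSucc_lt_last k), prod_Iic_castSucc, ← mul_assoc, h,
          inv_mul_cancel_left₀ (Finset.prod_ne_zero_iff.2 fun i _ => hqh _)]
        simp only [Fin.init]
      rw [Fin.prod_univ_castSucc, hl]
      simp only [hk, Fin.init]
      ring
    simp only [h1, h2]

/-- The exponents of annihilation modes, rescaled by the commutators. -/
def annExp (r : Fin 3 → ℂ) (p : ℂ) {n : ℕ} (c : Fin n → Fin 3) (e : Fin n → Exponent) :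
    Fin n → Mode → ℂ := fun k j => (e k).2 j * heisComm r p (c k) j

theorem prod_expOp (r : Fin 3 → ℂ) (p : ℂ) {n : ℕ} (c : Fin n → Fin 3) (e : Fin n → Exponent)
    (β α : Fin n → State) : ∏ k, expOp (heisComm r p (c k)) (e k) (β k) (α k) =
      tensorEntry (fun k => (e k).1) (annExp r p c e) β α := rfl

theorem annExp_sum (r : Fin 3 → ℂ) (p : ℂ) {n : ℕ} (c : Fin n → Fin 3) {ι : Type*} (s : Finset ι)
    (e : ι → Fin n → Exponent) :
    annExp r p c (∑ a ∈ s, e a) = ∑ a ∈ s, annExp r p c (e a) := by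
  funext k j
  simp only [annExp, Finset.sum_apply, Prod.snd_sum, Finset.sum_mul]

theorem toOp_single (r : Fin 3 → ℂ) (p : ℂ) {n : ℕ} (c : Fin n → Fin 3) (e : Fin n → Exponent)
    (a : ℂ) (β α : Fin n → State) : toOp r p c (AddMonoidAlgebra.single e a) β α =
      a * tensorEntry (fun k => (e k).1) (annExp r p c e) β α := by
  rw [toOp, AddMonoidAlgebra.coeff_single, Finsupp.sum_single_index (by simp), prod_expOp]

theorem toOp_add (r : Fin 3 → ℂ) (p : ℂ) {n : ℕ} (c : Fin n → Fin 3) (x y : Normal n)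
    (β α : Fin n → State) : toOp r p c (x + y) β α = toOp r p c x β α + toOp r p c y β α := by
  rw [toOp, AddMonoidAlgebra.coeff_add, Finsupp.sum_add_index' (by simp) (by intros; ring)]
  rfl

theorem toOp_sum (r : Fin 3 → ℂ) (p : ℂ) {n : ℕ} (c : Fin n → Fin 3) {ι : Type*} (s : Finset ι)
    (x : ι → Normal n) (β α : Fin n → State) :
    toOp r p c (∑ i ∈ s, x i) β α = ∑ i ∈ s, toOp r p c (x i) β α := by
  classical
  induction s using Finset.induction_on with
  | empty => simp [toOp]
  | insert i s hi ih => rw [Finset.sum_insert hi, Finset.sum_insert hi, toOp_add, ih]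

theorem vertexOp_eq (r : Fin 3 → ℂ) (p : ℂ) {n : ℕ} (c : Fin n → Fin 3) (u : Fin n → ℂ)
    (j : Fin n) (z : ℂ) :
    vertexOp r p c u j z = AddMonoidAlgebra.single (vertexExp r p c j z) (u j) := rfl

theorem prod_vertexOp (r : Fin 3 → ℂ) (p : ℂ) {n : ℕ} (c : Fin n → Fin 3) (u : Fin n → ℂ)
    {ι : Type*} (s : Finset ι) (J : ι → Fin n) (z : ι → ℂ) :
    ∏ a ∈ s, vertexOp r p c u (J a) (z a) =
      AddMonoidAlgebra.single (∑ a ∈ s, vertexExp r p c (J a) (z a)) (∏ a ∈ s, u (J a)) := by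
  classical
  induction s using Finset.induction_on with
  | empty => rfl
  | insert i s hi ih =>
    rw [Finset.prod_insert hi, Finset.prod_insert hi, Finset.sum_insert hi, ih, vertexOp_eq,
      AddMonoidAlgebra.single_mul_single]

/-! ### Contractions of vertex operators -/

theorem r_ne_zero {r : Fin 3 → ℂ} (hq : q r 0 * q r 1 * q r 2 = 1) (i : Fin 3) : r i ≠ 0 := by
  intro h
  fin_cases i <;> simp_all [q]

theorem q_ne_zero {r : Fin 3 → ℂ} (hq : q r 0 * q r 1 * q r 2 = 1) (i : Fin 3) : q r i ≠ 0 :=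
  pow_ne_zero 4 (r_ne_zero hq i)

theorem qh_ne_zero {r : Fin 3 → ℂ} (hq : q r 0 * q r 1 * q r 2 = 1) (i : Fin 3) : qh r i ≠ 0 :=
  pow_ne_zero 2 (r_ne_zero hq i)

theorem q_pow_ne_one {r : Fin 3 → ℂ}
    (hgen : ∀ L M N : ℤ, q r 0 ^ L * q r 1 ^ M * q r 2 ^ N = 1 → L = M ∧ M = N)
    (i : Fin 3) (n : ℕ+) : q r i ^ (n : ℕ) ≠ 1 := by
  intro h
  have hn := n.pos
  fin_cases i
  · have := hgen (n : ℕ) 0 0 (by simpa using h)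
    omega
  · have := hgen 0 (n : ℕ) 0 (by simpa using h)
    omega
  · have := hgen 0 0 (n : ℕ) (by simpa using h)
    omega

theorem kap_ne_zero {r : Fin 3 → ℂ}
    (hgen : ∀ L M N : ℤ, q r 0 ^ L * q r 1 ^ M * q r 2 ^ N = 1 → L = M ∧ M = N)
    (n : ℕ+) : kap r n ≠ 0 :=
  mul_ne_zero (mul_ne_zero (sub_ne_zero.2 (q_pow_ne_one hgen 0 n))
    (sub_ne_zero.2 (q_pow_ne_one hgen 1 n))) (sub_ne_zero.2 (q_pow_ne_one hgen 2 n))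

theorem q_pow_eq (r : Fin 3 → ℂ) (i : Fin 3) (n : ℕ) : q r i ^ n = (r i ^ n) ^ 4 := by
  rw [q, ← pow_mul, ← pow_mul, mul_comm]

theorem qh_pow_eq (r : Fin 3 → ℂ) (i : Fin 3) (n : ℕ) : qh r i ^ n = (r i ^ n) ^ 2 := by
  rw [qh, ← pow_mul, ← pow_mul, mul_comm]

theorem qdiff_eq {r : Fin 3 → ℂ} (hq : q r 0 * q r 1 * q r 2 = 1) (i : Fin 3) (n : ℕ) :
    qdiff r i n = (q r i ^ n - 1) / (r i ^ n) ^ 2 := by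
  have h : r i ^ n ≠ 0 := pow_ne_zero n (r_ne_zero hq i)
  rw [qdiff, qh_pow_eq, q_pow_eq]
  field_simp

theorem q_pow_mul {r : Fin 3 → ℂ} (hq : q r 0 * q r 1 * q r 2 = 1) (n : ℕ) :
    q r 0 ^ n * q r 1 ^ n * q r 2 ^ n = 1 := by
  rw [← mul_pow, ← mul_pow, hq, one_pow]

theorem kap_eq_sum {r : Fin 3 → ℂ} (hq : q r 0 * q r 1 * q r 2 = 1) (n : ℕ) :
    kap r n = ∑ j, (q r j ^ n - (q r j ^ n)⁻¹) := by
  have h := q_pow_mul hq n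
  have h0 : (q r 0 ^ n)⁻¹ = q r 1 ^ n * q r 2 ^ n := inv_eq_of_mul_eq_one_right (by
    rw [← mul_assoc, h])
  have h1 : (q r 1 ^ n)⁻¹ = q r 0 ^ n * q r 2 ^ n := inv_eq_of_mul_eq_one_right (by
    rw [← h]; ring)
  have h2 : (q r 2 ^ n)⁻¹ = q r 0 ^ n * q r 1 ^ n := inv_eq_of_mul_eq_one_left h
  rw [kap, Fin.sum_univ_three, h0, h1, h2]
  linear_combination h

/-- After division by `q_i ^ n - 1`, each of the six monomials becomes one theta function in the
contraction of `η` with `η`. The variant with inverses below serves the `b`-modes, and `kap_eq_sum`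
plays this role for `η` with `φ⁻`. -/
theorem kap_eq_mul {r : Fin 3 → ℂ} (hq : q r 0 * q r 1 * q r 2 = 1) (i : Fin 3) (n : ℕ) :
    kap r n = (q r i ^ n - 1) *
      ((q r i ^ n)⁻¹ + 1 + q r i ^ n - (q r 0 ^ n + q r 1 ^ n + q r 2 ^ n)) := by
  have h := q_pow_mul hq n
  have hi : q r i ^ n ≠ 0 := pow_ne_zero n (q_ne_zero hq i)
  have key : (q r i ^ n - 1) * ((q r i ^ n)⁻¹ + 1 + q r i ^ n -
      (q r 0 ^ n + q r 1 ^ n + q r 2 ^ n)) * q r i ^ n =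
      (q r i ^ n - 1) * (1 + q r i ^ n + q r i ^ n * q r i ^ n -
      (q r 0 ^ n + q r 1 ^ n + q r 2 ^ n) * q r i ^ n) := by
    field_simp
  refine mul_right_cancel₀ hi (Eq.trans ?_ key.symm)
  rw [kap]
  fin_cases i
  · simp only [Fin.zero_eta]
    linear_combination (q r 0 ^ n - 1) * h
  · simp only [Fin.mk_one]
    linear_combination (q r 1 ^ n - 1) * h
  · simp only [Fin.reduceFinMk]
    linear_combination (q r 2 ^ n - 1) * h

theorem kap_eq_mul_inv {r : Fin 3 → ℂ} (hq : q r 0 * q r 1 * q r 2 = 1) (i : Fin 3) (n : ℕ) :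
    kap r n * q r i ^ n = (q r i ^ n - 1) *
      ((q r i ^ n)⁻¹ + 1 + q r i ^ n - ((q r 0 ^ n)⁻¹ + (q r 1 ^ n)⁻¹ + (q r 2 ^ n)⁻¹)) := by
  have h := kap_eq_sum hq n
  rw [Fin.sum_univ_three] at h
  have h' := kap_eq_mul hq i n
  linear_combination h' + (q r i ^ n - 1) * h

/-- The rescaled exponents of the annihilation modes of `η^{(i)}(w)`. -/
def etaAnn (r : Fin 3 → ℂ) (i : Fin 3) (w : ℂ) : Mode → ℂ
  | Sum.inl n => -((r i ^ (n : ℕ))⁻¹ * (w ^ (n : ℕ))⁻¹)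
  | Sum.inr n => -(r i ^ (n : ℕ) * w ^ (n : ℕ))

/-- The commutator cancels `κ_n` and every factor depending on `p`, so in a contraction these come
only from the creation exponents of the right factor. -/
theorem etaExp_mul_heisComm {r : Fin 3 → ℂ} (hq : q r 0 * q r 1 * q r 2 = 1)
    (hgen : ∀ L M N : ℤ, q r 0 ^ L * q r 1 ^ M * q r 2 ^ N = 1 → L = M ∧ M = N)
    {p : ℂ} (hp0 : p ≠ 0) (hp : ‖p‖ < 1) (i : Fin 3) (w : ℂ) (j : Mode) :
    (etaExp r p i w).2 j * heisComm r p i j = etaAnn r i w j := by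
  rcases j with n | n
  all_goals
    have h1 := one_sub_pow_ne_zero hp n
    have h2 := kap_ne_zero hgen n
    have h3 := sub_ne_zero.2 (q_pow_ne_one hgen i n)
    have h4 : p ^ (n : ℕ) ≠ 0 := pow_ne_zero _ hp0
    have h5 : ((n : ℕ) : ℂ) ≠ 0 := by exact_mod_cast n.ne_zero
    have h6 : r i ^ (n : ℕ) ≠ 0 := pow_ne_zero _ (r_ne_zero hq i)
    simp only [etaExp, heisComm, etaAnn, qdiff_eq hq]
    rw [q_pow_eq] at h3 ⊢
  · field_simp
  · have h7 : ((r i ^ (n : ℕ)) ^ 4)⁻¹ - 1 ≠ 0 := by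
      intro h
      apply h3
      field_simp at h
      linear_combination -h
    have h8 : ((r i ^ (n : ℕ)) ^ 4)⁻¹ - 1 = -(((r i ^ (n : ℕ)) ^ 4 - 1) / (r i ^ (n : ℕ)) ^ 4) := by
      field_simp
      ring
    rw [h8]
    field_simp

theorem etaAnn_mul_etaExp {r : Fin 3 → ℂ} (hq : q r 0 * q r 1 * q r 2 = 1)
    (hgen : ∀ L M N : ℤ, q r 0 ^ L * q r 1 ^ M * q r 2 ^ N = 1 → L = M ∧ M = N)
    {p : ℂ} (hp : ‖p‖ < 1) (i : Fin 3) {w w' : ℂ} (hw : w ≠ 0) (hw' : w' ≠ 0) (j : Mode) :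
    etaAnn r i w j * (etaExp r p i w').1 j =
      (logTheta p (q r 0 * (w' / w)) j + logTheta p (q r 1 * (w' / w)) j +
        logTheta p (q r 2 * (w' / w)) j) -
      (logTheta p (w' / w) j + logTheta p ((q r i)⁻¹ * (w' / w)) j +
        logTheta p (q r i * (w' / w)) j) := by
  rcases j with n | n
  all_goals
    have h1 := one_sub_pow_ne_zero hp n
    have h3 := sub_ne_zero.2 (q_pow_ne_one hgen i n)
    have h5 : ((n : ℕ) : ℂ) ≠ 0 := by exact_mod_cast n.ne_zero
    have h6 : r i ^ (n : ℕ) ≠ 0 := pow_ne_zero _ (r_ne_zero hq i)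
    have h7 : w ^ (n : ℕ) ≠ 0 := pow_ne_zero _ hw
    have h8 : w' ^ (n : ℕ) ≠ 0 := pow_ne_zero _ hw'
    simp only [etaExp, etaAnn, qdiff_eq hq, logTheta, mul_pow, div_pow, mul_inv, inv_pow, inv_div,
      inv_inv]
  · have hk := kap_eq_mul hq i n
    calc _ = -(kap r n / (q r i ^ (n : ℕ) - 1)) *
          (w' ^ (n : ℕ) / w ^ (n : ℕ) / (n : ℕ) / (1 - p ^ (n : ℕ))) := by field_simp
      _ = _ := by rw [hk, mul_div_cancel_left₀ _ h3]; ring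
  · have hk := kap_eq_mul_inv hq i n
    calc _ = -(kap r n * q r i ^ (n : ℕ) / (q r i ^ (n : ℕ) - 1)) *
          (p ^ (n : ℕ) * (w ^ (n : ℕ) / w' ^ (n : ℕ)) / (n : ℕ) / (1 - p ^ (n : ℕ))) := by
            rw [q_pow_eq] at h3 ⊢
            field_simp
      _ = _ := by rw [hk, mul_div_cancel_left₀ _ h3]; ring

theorem etaAnn_mul_phiExp {r : Fin 3 → ℂ} (hq : q r 0 * q r 1 * q r 2 = 1)
    {p : ℂ} (hp : ‖p‖ < 1) (i : Fin 3) {w w' : ℂ} (hw : w ≠ 0) (hw' : w' ≠ 0) (j : Mode) :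
    etaAnn r i w j * (phiExp r p i (qh r i * w')).1 j =
      (logTheta p (q r 0 * (w' / w)) j + logTheta p (q r 1 * (w' / w)) j +
        logTheta p (q r 2 * (w' / w)) j) -
      (logTheta p ((q r 0)⁻¹ * (w' / w)) j + logTheta p ((q r 1)⁻¹ * (w' / w)) j +
        logTheta p ((q r 2)⁻¹ * (w' / w)) j) := by
  rcases j with n | n
  all_goals
    have h1 := one_sub_pow_ne_zero hp n
    have h5 : ((n : ℕ) : ℂ) ≠ 0 := by exact_mod_cast n.ne_zero
    have h6 : r i ^ (n : ℕ) ≠ 0 := pow_ne_zero _ (r_ne_zero hq i)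
    have h7 : w ^ (n : ℕ) ≠ 0 := pow_ne_zero _ hw
    have h8 : w' ^ (n : ℕ) ≠ 0 := pow_ne_zero _ hw'
    have hk := kap_eq_sum hq n
    rw [Fin.sum_univ_three] at hk
    simp only [phiExp, etaAnn, logTheta, mul_pow, div_pow, mul_inv, inv_pow, inv_div,
      inv_inv, qh_pow_eq]
  · calc _ = kap r n *
          (w' ^ (n : ℕ) / w ^ (n : ℕ) / (n : ℕ) / (1 - p ^ (n : ℕ))) := by field_simp
      _ = _ := by rw [hk]; ring
  · calc _ = -kap r n *
          (p ^ (n : ℕ) * (w ^ (n : ℕ) / w' ^ (n : ℕ)) / (n : ℕ) / (1 - p ^ (n : ℕ))) := by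
            field_simp
      _ = _ := by rw [hk]; ring

/-- The numerator of the scalar factor in the normal ordering of `Λ_j(z) Λ_k(x z)`. -/
def orderNum (r : Fin 3 → ℂ) (p : ℂ) {n : ℕ} (c : Fin n → Fin 3) (j k : Fin n) (x : ℂ) : ℂ :=
  if j = k then theta p x * theta p ((q r (c j))⁻¹ * x) * theta p (q r (c j) * x)
  else if j < k then theta p ((q r 0)⁻¹ * x) * theta p ((q r 1)⁻¹ * x) * theta p ((q r 2)⁻¹ * x)
  else theta p (q r 0 * x) * theta p (q r 1 * x) * theta p (q r 2 * x)

/-- The denominator of the scalar factor in the normal ordering of `Λ_j(z) Λ_k(x z)`. -/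
def orderDen (r : Fin 3 → ℂ) (p x : ℂ) : ℂ :=
  theta p (q r 0 * x) * theta p (q r 1 * x) * theta p (q r 2 * x)

theorem hasSum_logTheta_sub {p a₁ a₂ a₃ b₁ b₂ b₃ : ℂ} (hp : ‖p‖ < 1)
    (ha₁ : ‖a₁‖ < 1 ∧ ‖p * a₁⁻¹‖ < 1) (ha₂ : ‖a₂‖ < 1 ∧ ‖p * a₂⁻¹‖ < 1)
    (ha₃ : ‖a₃‖ < 1 ∧ ‖p * a₃⁻¹‖ < 1) (hb₁ : ‖b₁‖ < 1 ∧ ‖p * b₁⁻¹‖ < 1)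
    (hb₂ : ‖b₂‖ < 1 ∧ ‖p * b₂⁻¹‖ < 1) (hb₃ : ‖b₃‖ < 1 ∧ ‖p * b₃⁻¹‖ < 1) {f : Mode → ℂ}
    (hf : ∀ j, f j = (logTheta p a₁ j + logTheta p a₂ j + logTheta p a₃ j) -
      (logTheta p b₁ j + logTheta p b₂ j + logTheta p b₃ j)) :
    Summable f ∧ theta p a₁ * theta p a₂ * theta p a₃ ≠ 0 ∧
      Complex.exp (∑' j, f j) = theta p b₁ * theta p b₂ * theta p b₃ /
        (theta p a₁ * theta p a₂ * theta p a₃) := by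
  obtain ⟨A₁, hA₁, eA₁⟩ := exists_hasSum_logTheta hp ha₁.1 ha₁.2
  obtain ⟨A₂, hA₂, eA₂⟩ := exists_hasSum_logTheta hp ha₂.1 ha₂.2
  obtain ⟨A₃, hA₃, eA₃⟩ := exists_hasSum_logTheta hp ha₃.1 ha₃.2
  obtain ⟨B₁, hB₁, eB₁⟩ := exists_hasSum_logTheta hp hb₁.1 hb₁.2
  obtain ⟨B₂, hB₂, eB₂⟩ := exists_hasSum_logTheta hp hb₂.1 hb₂.2
  obtain ⟨B₃, hB₃, eB₃⟩ := exists_hasSum_logTheta hp hb₃.1 hb₃.2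
  have hs : HasSum f ((A₁ + A₂ + A₃) - (B₁ + B₂ + B₃)) :=
    hasSum_of_eq (((hA₁.add hA₂).add hA₃).sub ((hB₁.add hB₂).add hB₃)) hf rfl
  rw [← eA₁, ← eA₂, ← eA₃, ← eB₁, ← eB₂, ← eB₃]
  refine ⟨hs.summable, by simp, ?_⟩
  rw [hs.tsum_eq, ← Complex.exp_add, ← Complex.exp_add, ← Complex.exp_add, ← Complex.exp_add,
    ← Complex.exp_sub]
  congr 1
  ring

/-- `φ⁻` has no annihilation modes, so `Λ_j` standing on the left contracts only in the tensor
factor `j`. -/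
theorem annExp_vertexExp {r : Fin 3 → ℂ} (hq : q r 0 * q r 1 * q r 2 = 1)
    (hgen : ∀ L M N : ℤ, q r 0 ^ L * q r 1 ^ M * q r 2 ^ N = 1 → L = M ∧ M = N)
    {p : ℂ} (hp0 : p ≠ 0) (hp : ‖p‖ < 1) {n : ℕ} (c : Fin n → Fin 3) (j : Fin n) (z : ℂ)
    (k : Fin n) : annExp r p c (vertexExp r p c j z) k =
      if k = j then etaAnn r (c k) ((∏ i ∈ Finset.Iio k, qh r (c i)) * z) else 0 := by
  funext l
  simp only [annExp, vertexExp]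
  split_ifs with h1 h2 h2
  · exact absurd h1 (by simp [h2])
  · simp [phiExp]
  · exact etaExp_mul_heisComm hq hgen hp0 hp _ _ _
  · simp

/-- Normal ordering of two vertex operators. -/
theorem contraction_vertexExp {r : Fin 3 → ℂ} (hq : q r 0 * q r 1 * q r 2 = 1)
    (hgen : ∀ L M N : ℤ, q r 0 ^ L * q r 1 ^ M * q r 2 ^ N = 1 → L = M ∧ M = N)
    {p : ℂ} (hp0 : p ≠ 0) (hp : ‖p‖ < 1) {n : ℕ} (c : Fin n → Fin 3) (j k : Fin n) {z w : ℂ}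
    (hz : z ≠ 0) (hw : w ≠ 0) (h0 : ‖w / z‖ < 1 ∧ ‖p * (w / z)⁻¹‖ < 1)
    (h1 : ∀ i, ‖q r i * (w / z)‖ < 1 ∧ ‖p * (q r i * (w / z))⁻¹‖ < 1)
    (h2 : ∀ i, ‖(q r i)⁻¹ * (w / z)‖ < 1 ∧ ‖p * ((q r i)⁻¹ * (w / z))⁻¹‖ < 1) :
    (∀ l, Summable fun a => annExp r p c (vertexExp r p c j z) l a * (vertexExp r p c k w l).1 a) ∧
    orderDen r p (w / z) ≠ 0 ∧
    contraction (annExp r p c (vertexExp r p c j z)) (fun l => (vertexExp r p c k w l).1) =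
      orderNum r p c j k (w / z) / orderDen r p (w / z) := by
  have key : Summable (fun a => annExp r p c (vertexExp r p c j z) j a *
      (vertexExp r p c k w j).1 a) ∧ orderDen r p (w / z) ≠ 0 ∧
      Complex.exp (∑' a, annExp r p c (vertexExp r p c j z) j a *
      (vertexExp r p c k w j).1 a) = orderNum r p c j k (w / z) / orderDen r p (w / z) := by
    simp only [annExp_vertexExp hq hgen hp0 hp, if_true]
    have hC : ∏ i ∈ Finset.Iio j, qh r (c i) ≠ 0 :=
      Finset.prod_ne_zero_iff.2 fun i _ => qh_ne_zero hq _
    set C := ∏ i ∈ Finset.Iio j, qh r (c i)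
    -- In factor `j` both operators carry the same charge shift `C`, so only `w / z` enters.
    have hx : w / z = C * w / (C * z) := (mul_div_mul_left _ _ hC).symm
    have hw' := mul_ne_zero hC hw
    have hz' := mul_ne_zero hC hz
    rcases lt_trichotomy j k with hjk | hjk | hjk
    · have e1 : vertexExp r p c k w j = phiExp r p (c j) (qh r (c j) * (C * w)) := by
        rw [vertexExp, if_pos hjk, ← Finset.Iio_insert j, Finset.prod_insert (by simp), mul_assoc]
      rw [e1, orderNum, if_neg hjk.ne, if_pos hjk, orderDen]
      rw [hx] at h0 h1 h2 ⊢
      refine hasSum_logTheta_sub hp (h1 0) (h1 1) (h1 2) (h2 0) (h2 1) (h2 2)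
        (etaAnn_mul_phiExp hq hp _ hz' hw')
    · subst hjk
      have e1 : vertexExp r p c j w j = etaExp r p (c j) (C * w) := by
        rw [vertexExp, if_neg (lt_irrefl _), if_pos rfl]
      rw [e1, orderNum, if_pos rfl, orderDen]
      rw [hx] at h0 h1 h2 ⊢
      refine hasSum_logTheta_sub hp (h1 0) (h1 1) (h1 2) h0 (h2 _) (h1 _)
        (etaAnn_mul_etaExp hq hgen hp _ hz' hw')
    · have e1 : vertexExp r p c k w j = 0 := by
        rw [vertexExp, if_neg hjk.not_gt, if_neg hjk.ne']
      -- Here the right operator is trivial in factor `j` and the scalar is `1`. Equal numerator and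
      -- denominator are fed in only to learn that the denominator is nonzero.
      have h3 := hasSum_logTheta_sub (a₁ := q r 0 * (w / z)) (a₂ := q r 1 * (w / z))
        (a₃ := q r 2 * (w / z)) (b₁ := q r 0 * (w / z)) (b₂ := q r 1 * (w / z))
        (b₃ := q r 2 * (w / z)) hp (h1 0) (h1 1) (h1 2) (h1 0) (h1 1) (h1 2) (fun j => (sub_self _).symm)
      rw [e1, orderNum, if_neg hjk.ne', if_neg hjk.not_gt, orderDen]
      simpa [summable_zero] using h3
  refine ⟨fun l => ?_, key.2.1, ?_⟩
  · by_cases hl : l = j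
    · rw [hl]; exact key.1
    · simp [annExp_vertexExp hq hgen hp0 hp, hl, summable_zero]
  · rw [contraction, Finset.prod_eq_single j, key.2.2]
    · intro l _ hl
      simp [annExp_vertexExp hq hgen hp0 hp, hl]
    · simp

/-! ### The product of currents as a quotient of holomorphic functions -/

/-- For fixed row and fixed `f` an entry is a polynomial in finitely many exponents. -/
theorem differentiableOn_expEntry {E : Type*} [NormedAddCommGroup E] [NormedSpace ℂ E] {s : Set E}
    {c t : E → Mode → ℂ} (hc : ∀ j, DifferentiableOn ℂ (fun x => c x j) s)
    (ht : ∀ j, DifferentiableOn ℂ (fun x => t x j) s) (f : Fock) :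
    ∀ β, DifferentiableOn ℂ (fun x => expEntry (c x) (t x) β f) s := by
  induction f using MvPolynomial.induction_on with
  | C a =>
    intro β
    simp only [expEntry_C, coeff_expCre, Finsupp.prod, div_eq_mul_inv]
    exact (differentiableOn_prod _ fun j _ => ((hc j).pow _).mul_const _).const_mul a
  | add f g hf hg =>
    intro β
    simp only [expEntry_add]
    exact (hf β).add (hg β)
  | mul_X f j ih =>
    intro β
    by_cases hb : β j = 0
    · simp only [expEntry_mul_X_of_eq_zero _ _ _ _ _ hb]
      exact (ht j).mul (ih β)
    · obtain ⟨β, rfl⟩ := exists_add_single β j hb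
      simp only [expEntry_mul_X_add]
      exact ((ht j).mul (ih _)).add (ih β)

theorem differentiableOn_tensorEntry {E : Type*} [NormedAddCommGroup E] [NormedSpace ℂ E]
    {s : Set E} {n : ℕ} {c t : E → Fin n → Mode → ℂ}
    (hc : ∀ k j, DifferentiableOn ℂ (fun x => c x k j) s)
    (ht : ∀ k j, DifferentiableOn ℂ (fun x => t x k j) s) (β α : Fin n → State) :
    DifferentiableOn ℂ (fun x => tensorEntry (c x) (t x) β α) s :=
  differentiableOn_prod _ fun k _ => differentiableOn_expEntry (hc k) (ht k) _ _

theorem differentiableOn_vertexExp (r : Fin 3 → ℂ) {n m : ℕ} (c : Fin n → Fin 3)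
    (j : Fin n) (a : Fin m) (k : Fin n) (l : Mode)
    (hC : ∀ s : Finset (Fin n), ∏ i ∈ s, qh r (c i) ≠ 0) :
    DifferentiableOn ℂ (fun x : ℂ × (Fin m → ℂ) => (vertexExp r x.1 c j (x.2 a) k).1 l)
      (domain m) := by
  rintro x ⟨_, h1, h2⟩
  simp only [vertexExp]
  rcases l with l | l
  all_goals
    have e1 := one_sub_pow_ne_zero h1 l
    have e2 : ∀ s : Finset (Fin n), ((∏ i ∈ s, qh r (c i)) * x.2 a) ^ (l : ℕ) ≠ 0 := fun s =>
      pow_ne_zero _ (mul_ne_zero (hC s) (h2 a))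
    have e3 := e2 (Finset.Iic k)
    have e4 := e2 (Finset.Iio k)
    refine DifferentiableAt.differentiableWithinAt ?_
    split_ifs
    · simp only [phiExp]
      fun_prop (disch := assumption)
    · simp only [etaExp]
      fun_prop (disch := assumption)
    · simp

theorem differentiableOn_annExp {r : Fin 3 → ℂ} (hq : q r 0 * q r 1 * q r 2 = 1)
    (hgen : ∀ L M N : ℤ, q r 0 ^ L * q r 1 ^ M * q r 2 ^ N = 1 → L = M ∧ M = N)
    {n m : ℕ} (c : Fin n → Fin 3) (j : Fin n) (a : Fin m) (k : Fin n) (l : Mode) :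
    DifferentiableOn ℂ (fun x : ℂ × (Fin m → ℂ) =>
      annExp r x.1 c (vertexExp r x.1 c j (x.2 a)) k l) (domain m) := by
  have hC : ∏ i ∈ Finset.Iio k, qh r (c i) ≠ 0 :=
    Finset.prod_ne_zero_iff.2 fun i _ => qh_ne_zero hq _
  refine DifferentiableOn.congr (f := fun x => if k = j then
    etaAnn r (c k) ((∏ i ∈ Finset.Iio k, qh r (c i)) * x.2 a) l else 0) ?_ ?_
  · rintro x ⟨_, h1, h2⟩
    refine DifferentiableAt.differentiableWithinAt ?_
    split_ifs
    · rcases l with l | l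
      all_goals
        have e : ((∏ i ∈ Finset.Iio k, qh r (c i)) * x.2 a) ^ (l : ℕ) ≠ 0 :=
          pow_ne_zero _ (mul_ne_zero hC (h2 a))
        simp only [etaAnn]
        fun_prop (disch := assumption)
    · simp
  · rintro x ⟨h0, h1, h2⟩
    simp only [annExp_vertexExp hq hgen h0 h1]
    split_ifs <;> rfl

/-- The entry of `:Λ_{J_1}(z_1) ⋯ Λ_{J_m}(z_m):` (without the parameters `u`). -/
def orderedEntry (r : Fin 3 → ℂ) {n m : ℕ} (c : Fin n → Fin 3) (β α : Fin n → State)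
    (J : Fin m → Fin n) (x : ℂ × (Fin m → ℂ)) : ℂ :=
  tensorEntry (∑ a, fun k => (vertexExp r x.1 c (J a) (x.2 a) k).1)
    (∑ a, annExp r x.1 c (vertexExp r x.1 c (J a) (x.2 a))) β α

theorem differentiableOn_orderedEntry {r : Fin 3 → ℂ} (hq : q r 0 * q r 1 * q r 2 = 1)
    (hgen : ∀ L M N : ℤ, q r 0 ^ L * q r 1 ^ M * q r 2 ^ N = 1 → L = M ∧ M = N)
    {n m : ℕ} (c : Fin n → Fin 3) (β α : Fin n → State) (J : Fin m → Fin n) :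
    DifferentiableOn ℂ (orderedEntry r c β α J) (domain m) := by
  refine differentiableOn_tensorEntry (fun k j => ?_) (fun k j => ?_) β α
  · simp only [Finset.sum_apply]
    exact DifferentiableOn.fun_sum fun a _ => differentiableOn_vertexExp r c (J a) a k j
      fun s => Finset.prod_ne_zero_iff.2 fun i _ => qh_ne_zero hq _
  · simp only [Finset.sum_apply]
    exact DifferentiableOn.fun_sum fun a _ => differentiableOn_annExp hq hgen c (J a) a k j

/-- `θ_p(q₁) θ_p(q₂) θ_p(q₃)`. -/
def thetaProd (r : Fin 3 → ℂ) (p : ℂ) : ℂ := theta p (q r 0) * theta p (q r 1) * theta p (q r 2)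

/-- The coefficient of `Λ_j` in the image of `E(z)`, multiplied by `thetaProd ^ 2`. -/
def coefNum (r : Fin 3 → ℂ) {n : ℕ} (c : Fin n → Fin 3) (u : Fin n → ℂ) (p : ℂ) (j : Fin n) : ℂ :=
  thetaProd r p * ((qh r (c j))⁻¹ * qh r 2 * (theta p (q r 0) * theta p (q r 1)) *
    theta p (q r (c j)) * u j)

/-- One factor `thetaProd` clears the denominator of `dTilde₁`. The second makes the identity hold
at nomes where `thetaProd` vanishes too: both sides are then zero, whatever value division by zero
assigns to the coefficient. -/
theorem thetaProd_sq_mul (r : Fin 3 → ℂ) {n : ℕ} (c : Fin n → Fin 3) (u : Fin n → ℂ) {p : ℂ}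
    (hp : ‖p‖ < 1) (j : Fin n) :
    thetaProd r p ^ 2 * (uPrime r p c u j * dTilde₁ r p (c j)) = coefNum r c u p j := by
  by_cases h : thetaProd r p = 0
  · simp [coefNum, h]
  · have h1 := qPoch_ne_zero hp hp
    have h2 : theta p (q r (c j)) * ∏ i ∈ Finset.univ.erase (c j), theta p (q r i) =
        thetaProd r p := by
      rw [Finset.mul_prod_erase Finset.univ (fun i => theta p (q r i)) (Finset.mem_univ _), Fin.prod_univ_three]
      rfl
    have h3 : ∏ i ∈ Finset.univ.erase (c j), theta p (q r i) ≠ 0 := fun h0 => by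
      rw [h0, mul_zero] at h2; exact h h2.symm
    rw [coefNum, uPrime, dTilde₁]
    nth_rewrite 1 [sq, ← h2]
    field_simp

theorem hasProductEntry_sum {ι : Type} {n m : ℕ} (g : Fin n → ℂ)
    (B : Fin m → Fin n → Matrix ι ι ℂ) (β α : ι) (v : (Fin m → Fin n) → ℂ)
    (h : ∀ J, HasProductEntry (fun a => B a (J a)) β α (v J)) :
    HasProductEntry (fun a β α => ∑ j, g j * B a j β α) β α (∑ J, (∏ a, g (J a)) * v J) := by
  have h1 : HasSum (fun γ : Path m β α => ∑ J : Fin m → Fin n, (∏ a, g (J a)) *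
      ∏ a, B a (J a) (γ.1 a.castSucc) (γ.1 a.succ)) (∑ J, (∏ a, g (J a)) * v J) :=
    hasSum_sum fun J _ => (h J).mul_left _
  refine hasSum_of_eq h1 (fun γ => ?_) rfl
  rw [Finset.prod_univ_sum, Fintype.piFinset_univ]
  exact Finset.sum_congr rfl fun J _ => Finset.prod_mul_distrib

/-- Puts every theta argument occurring in a contraction into the annulus where the logarithmic
series converge; `s` will be `1`, `q_i` or `q_i⁻¹`. -/
theorem radial_estimate {m : ℕ} {R : ℝ} {x : ℂ × (Fin m → ℂ)} (hx : x ∈ radial m R) {a b : Fin m}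
    (hab : a < b) {s : ℂ} (hs0 : s ≠ 0) (hs : ‖s‖ < R) (hs' : ‖s⁻¹‖ < R) :
    ‖s * (x.2 b / x.2 a)‖ < 1 ∧ ‖x.1 * (s * (x.2 b / x.2 a))⁻¹‖ < 1 := by
  obtain ⟨⟨h0, h1, h2⟩, h3, h4⟩ := hx
  have ha := norm_pos_iff.2 (h2 a)
  have hb := norm_pos_iff.2 (h2 b)
  have hp := norm_pos_iff.2 h0
  have hs1 := norm_pos_iff.2 hs0
  have e1 := h3 a b hab
  have e2 := h4 a b
  rw [norm_inv] at hs'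
  rw [norm_mul] at e2
  constructor
  · rw [norm_mul, norm_div, mul_div_assoc', div_lt_one ha]
    exact lt_of_lt_of_le (by gcongr) e1
  · rw [norm_mul, norm_inv, norm_mul, norm_div, mul_inv, inv_div, mul_left_comm, ← mul_div_assoc,
      mul_div_assoc', div_lt_one hb]
    exact lt_of_lt_of_le (by gcongr) e2

/-- The product of the scalar factors `f a b` over `a < b`. -/
def pairProd {m : ℕ} (f : Fin m → Fin m → ℂ) : ℂ := ∏ a, ∏ b, if a < b then f a b else 1

theorem pairProd_div {m : ℕ} (f g : Fin m → Fin m → ℂ) :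
    pairProd (fun a b => f a b / g a b) = pairProd f / pairProd g := by
  simp only [pairProd, ← Finset.prod_div_distrib]
  refine Finset.prod_congr rfl fun a _ => Finset.prod_congr rfl fun b _ => ?_
  split_ifs <;> simp

theorem pairProd_ne_zero {m : ℕ} {f : Fin m → Fin m → ℂ} (h : ∀ a b, a < b → f a b ≠ 0) :
    pairProd f ≠ 0 :=
  Finset.prod_ne_zero_iff.2 fun a _ => Finset.prod_ne_zero_iff.2 fun b _ => by
    split_ifs with hab
    · exact h a b hab
    · exact one_ne_zero

theorem exists_radius (r : Fin 3 → ℂ) :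
    ∃ R : ℝ, 1 < R ∧ ∀ i, ‖q r i‖ < R ∧ ‖(q r i)⁻¹‖ < R := by
  refine ⟨2 + ∑ i, (‖q r i‖ + ‖(q r i)⁻¹‖), ?_, fun i => ?_⟩
  · have : 0 ≤ ∑ i, (‖q r i‖ + ‖(q r i)⁻¹‖) := Finset.sum_nonneg fun i _ => by positivity
    linarith
  · have h := Finset.single_le_sum (f := fun i => ‖q r i‖ + ‖(q r i)⁻¹‖)
      (fun i _ => by positivity) (Finset.mem_univ i)
    have h1 := norm_nonneg (q r i)
    have h2 := norm_nonneg (q r i)⁻¹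
    constructor <;> linarith

theorem hasProductEntry_tensorRep {r : Fin 3 → ℂ} (hq : q r 0 * q r 1 * q r 2 = 1)
    (hgen : ∀ L M N : ℤ, q r 0 ^ L * q r 1 ^ M * q r 2 ^ N = 1 → L = M ∧ M = N)
    {n m : ℕ} (c : Fin n → Fin 3) (v : Fin n → ℂ) {R : ℝ} (hR : 1 < R)
    (hR' : ∀ i, ‖q r i‖ < R ∧ ‖(q r i)⁻¹‖ < R) {x : ℂ × (Fin m → ℂ)} (hx : x ∈ radial m R)
    (β α : Fin n → State) :
    (∀ a b, a < b → orderDen r x.1 (x.2 b / x.2 a) ≠ 0) ∧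
    HasProductEntry (fun a => (tensorRep r x.1 n c v).E (x.2 a)) β α
      (∑ J : Fin m → Fin n, (∏ a, v (J a) * dTilde₁ r x.1 (c (J a))) *
        (pairProd (fun a b => orderNum r x.1 c (J a) (J b) (x.2 b / x.2 a) /
          orderDen r x.1 (x.2 b / x.2 a)) * orderedEntry r c β α J x)) := by
  have hr := r_ne_zero hq
  have key := fun (j k : Fin n) (a b : Fin m) (hab : a < b) =>
    contraction_vertexExp hq hgen hx.1.1 hx.1.2.1 c j k (hx.1.2.2 a) (hx.1.2.2 b)
      (by simpa using radial_estimate hx hab one_ne_zero (by simpa using hR) (by simpa using hR))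
      (fun i => radial_estimate hx hab (q_ne_zero hq i) (hR' i).1 (hR' i).2)
      (fun i => radial_estimate hx hab (inv_ne_zero (q_ne_zero hq i)) (hR' i).2
        (by simpa using (hR' i).1))
  -- Proved apart from `key`, which needs a pair of sites and so says nothing when `n = 0`.
  have hden : ∀ a b : Fin m, a < b → orderDen r x.1 (x.2 b / x.2 a) ≠ 0 := by
    intro a b hab
    have h := fun (s : ℂ) => radial_estimate (s := s) hx hab
    have h' := hasSum_logTheta_sub hx.1.2.1
      (h _ (q_ne_zero hq 0) (hR' 0).1 (hR' 0).2) (h _ (q_ne_zero hq 1) (hR' 1).1 (hR' 1).2)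
      (h _ (q_ne_zero hq 2) (hR' 2).1 (hR' 2).2) (h _ (q_ne_zero hq 0) (hR' 0).1 (hR' 0).2)
      (h _ (q_ne_zero hq 1) (hR' 1).1 (hR' 1).2) (h _ (q_ne_zero hq 2) (hR' 2).1 (hR' 2).2)
      (fun j => (sub_self _).symm)
    exact h'.2.1
  refine ⟨hden, ?_⟩
  have h1 : (fun a => (tensorRep r x.1 n c v).E (x.2 a)) = fun a β α =>
      ∑ j, (v j * dTilde₁ r x.1 (c j)) *
        tensorEntry (fun k => (vertexExp r x.1 c j (x.2 a) k).1)
          (annExp r x.1 c (vertexExp r x.1 c j (x.2 a))) β α := by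
    funext a β α
    rw [tensorRep_E r hr]
    rfl
  rw [h1]
  refine hasProductEntry_sum (fun j => v j * dTilde₁ r x.1 (c j))
    (fun a j => tensorEntry (fun k => (vertexExp r x.1 c j (x.2 a) k).1)
          (annExp r x.1 c (vertexExp r x.1 c j (x.2 a)))) β α _ fun J => ?_
  have h2 := hasProductEntry_tensorEntry
    (fun a k => (vertexExp r x.1 c (J a) (x.2 a) k).1)
    (fun a => annExp r x.1 c (vertexExp r x.1 c (J a) (x.2 a)))
    (fun a b hab => (key (J a) (J b) a b hab).1) β α
  convert h2 using 2
  swap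
  · rfl
  refine Finset.prod_congr rfl fun a _ => Finset.prod_congr rfl fun b _ => ?_
  split_ifs with hab
  · exact (key (J a) (J b) a b hab).2.2.symm
  · rfl

theorem differentiableOn_theta_fst {m : ℕ} {a : ℂ} (ha : a ≠ 0) :
    DifferentiableOn ℂ (fun x : ℂ × (Fin m → ℂ) => theta x.1 a) (domain m) :=
  DifferentiableOn.theta (by fun_prop) (by fun_prop) (fun x hx => hx.2.1) fun _ _ => ha

theorem differentiableOn_theta_ratio {m : ℕ} {s : ℂ} (hs : s ≠ 0) (a b : Fin m) :
    DifferentiableOn ℂ (fun x : ℂ × (Fin m → ℂ) => theta x.1 (s * (x.2 b / x.2 a)))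
      (domain m) := by
  refine DifferentiableOn.theta (by fun_prop) ?_ (fun x hx => hx.2.1) fun x hx =>
    mul_ne_zero hs (div_ne_zero (hx.2.2 _) (hx.2.2 _))
  intro x hx
  have h := hx.2.2 a
  refine DifferentiableAt.differentiableWithinAt ?_
  fun_prop (disch := assumption)

theorem differentiableOn_thetaProd {r : Fin 3 → ℂ} (hq : q r 0 * q r 1 * q r 2 = 1) (m : ℕ) :
    DifferentiableOn ℂ (fun x : ℂ × (Fin m → ℂ) => thetaProd r x.1) (domain m) :=
  ((differentiableOn_theta_fst (q_ne_zero hq 0)).mul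
    (differentiableOn_theta_fst (q_ne_zero hq 1))).mul (differentiableOn_theta_fst (q_ne_zero hq 2))

theorem differentiableOn_orderDen {r : Fin 3 → ℂ} (hq : q r 0 * q r 1 * q r 2 = 1) {m : ℕ}
    (a b : Fin m) :
    DifferentiableOn ℂ (fun x : ℂ × (Fin m → ℂ) => orderDen r x.1 (x.2 b / x.2 a)) (domain m) :=
  ((differentiableOn_theta_ratio (q_ne_zero hq 0) a b).mul
    (differentiableOn_theta_ratio (q_ne_zero hq 1) a b)).mul
    (differentiableOn_theta_ratio (q_ne_zero hq 2) a b)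

theorem differentiableOn_orderNum {r : Fin 3 → ℂ} (hq : q r 0 * q r 1 * q r 2 = 1) {n m : ℕ}
    (c : Fin n → Fin 3) (j k : Fin n) (a b : Fin m) :
    DifferentiableOn ℂ (fun x : ℂ × (Fin m → ℂ) => orderNum r x.1 c j k (x.2 b / x.2 a))
      (domain m) := by
  have h1 : DifferentiableOn ℂ (fun x : ℂ × (Fin m → ℂ) => theta x.1 (x.2 b / x.2 a))
      (domain m) := by
    simpa using differentiableOn_theta_ratio one_ne_zero a b
  have h2 := fun i => differentiableOn_theta_ratio (q_ne_zero hq i) a b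
  have h3 := fun i => differentiableOn_theta_ratio (inv_ne_zero (q_ne_zero hq i)) a b
  simp only [orderNum]
  split_ifs
  · exact (h1.mul (h3 _)).mul (h2 _)
  · exact ((h3 0).mul (h3 1)).mul (h3 2)
  · exact ((h2 0).mul (h2 1)).mul (h2 2)

theorem differentiableOn_pairProd {m : ℕ} {f : Fin m → Fin m → ℂ × (Fin m → ℂ) → ℂ}
    (h : ∀ a b, DifferentiableOn ℂ (f a b) (domain m)) :
    DifferentiableOn ℂ (fun x => pairProd fun a b => f a b x) (domain m) :=
  differentiableOn_prod _ fun a _ => differentiableOn_prod _ fun b _ => by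
    split_ifs
    · exact h a b
    · exact differentiableOn_const _

/-- Products of the current `E` continue meromorphically to every point at which the
denominators do not vanish. -/
theorem hasContinuedProductEntry_tensorRep {r : Fin 3 → ℂ} (hq : q r 0 * q r 1 * q r 2 = 1)
    (hgen : ∀ L M N : ℤ, q r 0 ^ L * q r 1 ^ M * q r 2 ^ N = 1 → L = M ∧ M = N)
    {n m : ℕ} (c : Fin n → Fin 3) (u : Fin n → ℂ) (β α : Fin n → State)
    {x : ℂ × (Fin m → ℂ)} (hx : x ∈ domain m) (hQ : thetaProd r x.1 ≠ 0)
    (hden : ∀ a b, a < b → orderDen r x.1 (x.2 b / x.2 a) ≠ 0) :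
    HasContinuedProductEntry (fun p w => (tensorRep r p n c (uPrime r p c u)).E w) x.1 x.2 β α
      (∑ J : Fin m → Fin n, (∏ a, uPrime r x.1 c u (J a) * dTilde₁ r x.1 (c (J a))) *
        (pairProd (fun a b => orderNum r x.1 c (J a) (J b) (x.2 b / x.2 a) /
          orderDen r x.1 (x.2 b / x.2 a)) * orderedEntry r c β α J x)) := by
  let N : ℂ × (Fin m → ℂ) → ℂ := fun x => ∑ J : Fin m → Fin n, (∏ a, coefNum r c u x.1 (J a)) *
    (pairProd (fun a b => orderNum r x.1 c (J a) (J b) (x.2 b / x.2 a)) * orderedEntry r c β α J x)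
  let D : ℂ × (Fin m → ℂ) → ℂ := fun x =>
    (thetaProd r x.1 ^ 2) ^ m * pairProd (fun a b => orderDen r x.1 (x.2 b / x.2 a))
  -- This identity serves both in the radial region and at the target point. It does not assume
  -- `thetaProd ≠ 0`, because the radial region contains all nomes, including zeros of `thetaProd`.
  have key : ∀ x : ℂ × (Fin m → ℂ), ‖x.1‖ < 1 →
      (∀ a b, a < b → orderDen r x.1 (x.2 b / x.2 a) ≠ 0) →
      D x * (∑ J : Fin m → Fin n, (∏ a, uPrime r x.1 c u (J a) * dTilde₁ r x.1 (c (J a))) *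
        (pairProd (fun a b => orderNum r x.1 c (J a) (J b) (x.2 b / x.2 a) /
          orderDen r x.1 (x.2 b / x.2 a)) * orderedEntry r c β α J x)) = N x := by
    intro x hp h
    have hP := pairProd_ne_zero h
    simp only [N, D]
    rw [Finset.mul_sum]
    refine Finset.sum_congr rfl fun J _ => ?_
    simp only [← thetaProd_sq_mul r c u hp, Finset.prod_mul_distrib, Finset.prod_const,
      Finset.card_univ, Fintype.card_fin, pairProd_div]
    field_simp
  have hD : D x ≠ 0 := mul_ne_zero (pow_ne_zero _ (pow_ne_zero _ hQ)) (pairProd_ne_zero hden)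
  obtain ⟨R, hR, hR'⟩ := exists_radius r
  refine ⟨hx, N, D, ?_, ?_, ⟨R, fun y hy => ?_⟩, hD, ?_⟩
  · refine DifferentiableOn.fun_sum fun J _ => ?_
    refine (differentiableOn_prod _ fun a _ => ?_).mul ((differentiableOn_pairProd fun a b =>
      differentiableOn_orderNum hq c _ _ a b).mul (differentiableOn_orderedEntry hq hgen c β α J))
    refine (differentiableOn_thetaProd hq m).mul (DifferentiableOn.mul_const (DifferentiableOn.mul
      (DifferentiableOn.const_mul ?_ _) (differentiableOn_theta_fst (q_ne_zero hq _))) _)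
    exact (differentiableOn_theta_fst (q_ne_zero hq 0)).mul
      (differentiableOn_theta_fst (q_ne_zero hq 1))
  · exact (((differentiableOn_thetaProd hq m).pow 2).pow m).mul
      (differentiableOn_pairProd fun a b => differentiableOn_orderDen hq a b)
  · obtain ⟨h1, h2⟩ := hasProductEntry_tensorRep hq hgen c (uPrime r y.1 c u) hR hR' hy β α
    exact ⟨_, h2, key y hy.1.2.1 h1⟩
  · rw [eq_div_iff hD, mul_comm]
    exact key x hx.2.1 hden

/-! ### Specialization of the arguments -/

/-- The coefficient of `u_j Λ_j` in the image of `E(z)`, for `c_j = i`. -/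
def vertexCoef (r : Fin 3 → ℂ) (p : ℂ) (i : Fin 3) : ℂ :=
  (qh r i)⁻¹ * qh r 2 * (theta p (q r i) / theta p (q r 2))

/-- The scalar factor in the normal ordering of `Λ_j(z) Λ_k(q₃ ^ d z)`. -/
def orderFactor (r : Fin 3 → ℂ) (p : ℂ) {n : ℕ} (c : Fin n → Fin 3) (j k : Fin n) (d : ℕ) : ℂ :=
  if k < j then 1 else orderNum r p c j k (q r 2 ^ d) / orderDen r p (q r 2 ^ d)

/-- The scalar factor in the normal ordering of `Λ_j(z)` and the vertex operators labelled by `L`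
at `q₃ ^ d z, q₃ ^ (d + 1) z, …`. -/
def crossFactor (r : Fin 3 → ℂ) (p : ℂ) {n : ℕ} (c : Fin n → Fin 3) (j : Fin n) :
    List (Fin n) → ℕ → ℂ
  | [], _ => 1
  | k :: L, d => orderFactor r p c j k d * crossFactor r p c j L (d + 1)

/-- The normal ordering of the product of the vertex operators labelled by a list of length `m`
at `q₃ ^ (1 - m) z, …, q₃⁻¹ z, z`. -/
def listTerm (r : Fin 3 → ℂ) (p : ℂ) {n : ℕ} (c : Fin n → Fin 3) (u : Fin n → ℂ) (z : ℂ) :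
    List (Fin n) → Normal n
  | [] => 1
  | j :: L => (vertexCoef r p (c j) * crossFactor r p c j L 1) •
      (vertexOp r p c u j ((q r 2 ^ L.length)⁻¹ * z) * listTerm r p c u z L)

/-- The sum of `φ` over all lists of length `k` with entries in `S`. -/
def sumLists {n : ℕ} {M : Type*} [AddCommMonoid M] (S : Finset (Fin n)) :
    ℕ → (List (Fin n) → M) → M
  | 0, φ => φ []
  | k + 1, φ => ∑ j ∈ S, sumLists S k fun L => φ (j :: L)

theorem sumLists_congr {n : ℕ} {M : Type*} [AddCommMonoid M] {S : Finset (Fin n)} {k : ℕ}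
    {φ ψ : List (Fin n) → M} (h : ∀ L : List (Fin n), L.length = k → (∀ j ∈ L, j ∈ S) → φ L = ψ L) :
    sumLists S k φ = sumLists S k ψ := by
  induction k generalizing φ ψ with
  | zero => exact h [] rfl (by simp)
  | succ k ih =>
    refine Finset.sum_congr rfl fun j hj => ih fun L hL hS => h _ (by simp [hL]) ?_
    simpa [hj] using hS

theorem sumLists_mul_left {n : ℕ} {M : Type*} [NonUnitalNonAssocSemiring M] {S : Finset (Fin n)}
    {k : ℕ} (a : M) (φ : List (Fin n) → M) :
    sumLists S k (fun L => a * φ L) = a * sumLists S k φ := by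
  induction k generalizing φ with
  | zero => rfl
  | succ k ih => simp only [sumLists, ih, Finset.mul_sum]

theorem sumLists_insert {n : ℕ} {M : Type*} [AddCommMonoid M] {S : Finset (Fin n)} {t : Fin n}
    (ht : t ∉ S) {k : ℕ} {φ : List (Fin n) → M} (h : ∀ L : List (Fin n), t ∈ L → φ L = 0) :
    sumLists (insert t S) k φ = sumLists S k φ := by
  have h0 : ∀ k (ψ : List (Fin n) → M), (∀ L, ψ L = 0) → sumLists (insert t S) k ψ = 0 := by
    intro k
    induction k with
    | zero => intro ψ hψ; exact hψ _
    | succ k ih => intro ψ hψ; exact Finset.sum_eq_zero fun j _ => ih _ fun L => hψ _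
  induction k generalizing φ with
  | zero => rfl
  | succ k ih =>
    simp only [sumLists]
    rw [Finset.sum_insert ht, h0 _ _ fun L => h _ (by simp), zero_add]
    exact Finset.sum_congr rfl fun j _ => ih fun L hL => h _ (by simp [hL])

theorem sumLists_univ {n : ℕ} {M : Type*} [AddCommMonoid M] (k : ℕ) (φ : List (Fin n) → M) :
    sumLists Finset.univ k φ = ∑ J : Fin k → Fin n, φ (List.ofFn J) := by
  induction k generalizing φ with
  | zero => simp [sumLists]
  | succ k ih =>
    rw [← (Fin.consEquiv fun _ : Fin (k + 1) => Fin n).sum_comp, Fintype.sum_prod_type]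
    simp [sumLists, ih, Fin.consEquiv, List.ofFn_succ]

theorem crossFactor_append (r : Fin 3 → ℂ) (p : ℂ) {n : ℕ} (c : Fin n → Fin 3) (j : Fin n)
    (L L' : List (Fin n)) (d : ℕ) : crossFactor r p c j (L ++ L') d =
      crossFactor r p c j L d * crossFactor r p c j L' (d + L.length) := by
  induction L generalizing d with
  | nil => simp [crossFactor]
  | cons k L ih =>
    simp only [List.cons_append, crossFactor, ih, List.length_cons, mul_assoc]
    congr 3
    omega

theorem crossFactor_eq_one (r : Fin 3 → ℂ) (p : ℂ) {n : ℕ} (c : Fin n → Fin 3) (j : Fin n)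
    (L : List (Fin n)) (h : ∀ k ∈ L, k < j) (d : ℕ) : crossFactor r p c j L d = 1 := by
  induction L generalizing d with
  | nil => rfl
  | cons k L ih =>
    rw [crossFactor, ih (fun k hk => h k (by simp [hk])), orderFactor, if_pos (h k (by simp)),
      one_mul]

theorem crossFactor_ofFn (r : Fin 3 → ℂ) (p : ℂ) {n m : ℕ} (c : Fin n → Fin 3) (j : Fin n)
    (J : Fin m → Fin n) (d : ℕ) : crossFactor r p c j (List.ofFn J) d =
      ∏ a : Fin m, orderFactor r p c j (J a) (d + a) := by
  induction m generalizing d with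
  | zero => simp [crossFactor]
  | succ m ih =>
    rw [List.ofFn_succ, crossFactor, ih, Fin.prod_univ_succ]
    congr 1
    refine Finset.prod_congr rfl fun a _ => ?_
    rw [Fin.val_succ]
    congr 1
    omega

theorem crossFactor_replicate (r : Fin 3 → ℂ) (p : ℂ) {n : ℕ} (c : Fin n → Fin 3) (j : Fin n)
    (l d : ℕ) : crossFactor r p c j (List.replicate l j) d =
      ∏ a ∈ Finset.range l, orderFactor r p c j j (d + a) := by
  induction l generalizing d with
  | zero => simp [crossFactor]
  | succ l ih =>
    rw [List.replicate_succ, crossFactor, ih, Finset.prod_range_succ', mul_comm]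
    congr 1
    refine Finset.prod_congr rfl fun a _ => ?_
    congr 1
    omega

theorem pairProd_succ {m : ℕ} (f : Fin (m + 1) → Fin (m + 1) → ℂ) :
    pairProd f = (∏ b : Fin m, f 0 b.succ) * pairProd fun a b : Fin m => f a.succ b.succ := by
  rw [pairProd, Fin.prod_univ_succ]
  simp [Fin.prod_univ_succ (n := m), pairProd, Fin.succ_pos]

theorem listTerm_ofFn (r : Fin 3 → ℂ) (p : ℂ) {n m : ℕ}
    (c : Fin n → Fin 3) (u : Fin n → ℂ) (z : ℂ) (J : Fin m → Fin n) :
    listTerm r p c u z (List.ofFn J) =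
      ((∏ a, vertexCoef r p (c (J a))) *
        pairProd fun a b => orderFactor r p c (J a) (J b) ((b : ℕ) - (a : ℕ))) •
      ∏ a : Fin m, vertexOp r p c u (J a) (q r 2 ^ (-(m : ℤ) + 1 + (a : ℕ)) * z) := by
  induction m with
  | zero => simp [listTerm, pairProd]
  | succ m ih =>
    rw [List.ofFn_succ, listTerm, ih, Fin.prod_univ_succ, Fin.prod_univ_succ (n := m), pairProd_succ,
      crossFactor_ofFn, List.length_ofFn, mul_smul_comm, smul_smul]
    have e1 : (q r 2 ^ m)⁻¹ = q r 2 ^ (-((m + 1 : ℕ) : ℤ) + 1 + (((0 : Fin (m + 1)) : ℕ) : ℤ)) := by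
      rw [← zpow_natCast, ← zpow_neg]
      congr 1
      simp
    have e2 : ∀ a : Fin m, -((m + 1 : ℕ) : ℤ) + 1 + ((a.succ : ℕ) : ℤ) =
        -(m : ℤ) + 1 + ((a : ℕ) : ℤ) := by
      intro a
      rw [Fin.val_succ]
      push_cast
      ring
    have e3 : ∀ a : Fin m, 1 + (a : ℕ) = (a.succ : ℕ) - ((0 : Fin (m + 1)) : ℕ) := by
      intro a
      simp [add_comm]
    have e4 : ∀ a b : Fin m, (b.succ : ℕ) - (a.succ : ℕ) = (b : ℕ) - (a : ℕ) := by
      intro a b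
      simp
    rw [e1]
    simp only [e2, e3, e4]
    exact congrArg₂ (· • ·) (mul_mul_mul_comm _ _ _ _) rfl

theorem listTerm_append_eq_zero (r : Fin 3 → ℂ) (p : ℂ) {n : ℕ} (c : Fin n → Fin 3) (u : Fin n → ℂ)
    (z : ℂ) (L₀ : List (Fin n)) {L : List (Fin n)} (h : listTerm r p c u z L = 0) :
    listTerm r p c u z (L₀ ++ L) = 0 := by
  induction L₀ with
  | nil => exact h
  | cons j L₀ ih => rw [List.cons_append, listTerm, ih, mul_zero, smul_zero]

/-- The numerator contains `θ_p(q₃⁻¹ q₃) = θ_p(1)`. -/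
theorem orderFactor_of_lt {r : Fin 3 → ℂ} (hq : q r 0 * q r 1 * q r 2 = 1) {p : ℂ} (hp : ‖p‖ < 1)
    {n : ℕ} (c : Fin n → Fin 3) {j k : Fin n} (h : j < k) : orderFactor r p c j k 1 = 0 := by
  rw [orderFactor, if_neg h.not_gt, orderNum, if_neg h.ne, if_pos h, pow_one,
    inv_mul_cancel₀ (q_ne_zero hq 2), theta_one hp]
  simp

/-- A word that ever exceeds its first letter has two neighbouring letters in increasing order, and
their factor vanishes. -/
theorem listTerm_eq_zero {r : Fin 3 → ℂ} (hq : q r 0 * q r 1 * q r 2 = 1) {p : ℂ} (hp : ‖p‖ < 1)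
    {n : ℕ} (c : Fin n → Fin 3) (u : Fin n → ℂ) (z : ℂ) {t : Fin n} (L : List (Fin n)) (ht : t ∈ L) :
    ∀ j, j < t → listTerm r p c u z (j :: L) = 0 := by
  induction L with
  | nil => simp at ht
  | cons k L ih =>
    intro j hj
    by_cases hjk : j < k
    · rw [listTerm, crossFactor, orderFactor_of_lt hq hp c hjk, zero_mul, mul_zero, zero_smul]
    · have hkt : k < t := (not_lt.1 hjk).trans_lt hj
      have : t ∈ L := by
        rcases List.mem_cons.1 ht with h | h
        · exact absurd h hkt.ne'
        · exact h
      rw [listTerm, ih this k hkt, mul_zero, smul_zero]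

/-- Letters on the left that are larger contract trivially with those on the right; only the
positions of the block feel the length of `L`. -/
theorem listTerm_replicate_append (r : Fin 3 → ℂ) (p : ℂ) {n : ℕ} (c : Fin n → Fin 3)
    (u : Fin n → ℂ) (z : ℂ) (t : Fin n) (l : ℕ) (L : List (Fin n)) (h : ∀ k ∈ L, k < t) :
    listTerm r p c u z (List.replicate l t ++ L) =
      listTerm r p c u ((q r 2 ^ L.length)⁻¹ * z) (List.replicate l t) * listTerm r p c u z L := by
  induction l with
  | zero => simp [listTerm]
  | succ l ih =>
    rw [List.replicate_succ, List.cons_append, listTerm, listTerm, ih, crossFactor_append,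
      crossFactor_eq_one _ _ _ _ _ h, mul_one, smul_mul_assoc, mul_assoc, List.length_append, pow_add,
      mul_inv, mul_assoc]

/-- Only non-increasing lists contribute. -/
theorem sumLists_listTerm_insert {r : Fin 3 → ℂ} (hq : q r 0 * q r 1 * q r 2 = 1) {p : ℂ}
    (hp : ‖p‖ < 1) {n : ℕ} (c : Fin n → Fin 3) (u : Fin n → ℂ) (z : ℂ) {t : Fin n}
    {S : Finset (Fin n)} (hS : ∀ j ∈ S, j < t) (k l : ℕ) :
    sumLists (insert t S) k (fun L => listTerm r p c u z (List.replicate l t ++ L)) =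
      ∑ x ∈ Finset.HasAntidiagonal.antidiagonal k,
        sumLists S x.2 (fun L => listTerm r p c u z (List.replicate (l + x.1) t ++ L)) := by
  have ht : t ∉ S := fun h => lt_irrefl _ (hS t h)
  induction k generalizing l with
  | zero => simp [sumLists]
  | succ k ih =>
    rw [sumLists, Finset.sum_insert ht, Finset.Nat.antidiagonal_succ, Finset.sum_cons,
      Finset.sum_map, add_comm]
    congr 1
    -- Once a letter smaller than `t` has occurred, `t` cannot come back.
    · refine Finset.sum_congr rfl fun j hj => sumLists_insert ht fun L hL => ?_
      exact listTerm_append_eq_zero _ _ _ _ _ _ (listTerm_eq_zero hq hp c u z L hL j (hS j hj))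
    · have e : ∀ L, List.replicate l t ++ t :: L = List.replicate (l + 1) t ++ L := by
        intro L
        rw [List.replicate_succ', List.append_assoc]
        rfl
      simp only [e, ih]
      refine Finset.sum_congr rfl fun x _ => ?_
      simp [add_assoc, add_comm 1]

/-! ### Comparison with the Miura transformation -/

/-- The scalar produced when a further copy of `Λ_t` is put in front of `s` copies, `c_t = i`. -/
def blockStep (r : Fin 3 → ℂ) (p : ℂ) {n : ℕ} (c : Fin n → Fin 3) (t : Fin n) (s : ℕ) : ℂ :=
  vertexCoef r p (c t) * ∏ a ∈ Finset.range s, orderFactor r p c t t (1 + a)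

theorem listTerm_replicate (r : Fin 3 → ℂ) (p : ℂ) {n : ℕ} (c : Fin n → Fin 3) (u : Fin n → ℂ)
    (z : ℂ) (t : Fin n) (l : ℕ) : listTerm r p c u z (List.replicate l t) =
      (∏ s ∈ Finset.range l, blockStep r p c t s) •
        ∏ j ∈ Finset.range l, vertexOp r p c u t ((q r 2 ^ j)⁻¹ * z) := by
  induction l with
  | zero => simp [listTerm]
  | succ l ih =>
    rw [List.replicate_succ, listTerm, ih, crossFactor_replicate, List.length_replicate,
      Finset.prod_range_succ, Finset.prod_range_succ, mul_smul_comm, smul_smul,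
      mul_comm (vertexOp _ _ _ _ _ _), mul_comm (∏ s ∈ Finset.range l, blockStep r p c t s)]
    rfl

theorem orderFactor_self (r : Fin 3 → ℂ) (p : ℂ) {n : ℕ} (c : Fin n → Fin 3) (t : Fin n) (d : ℕ) :
    orderFactor r p c t t d = theta p (q r 2 ^ d) * theta p ((q r (c t))⁻¹ * q r 2 ^ d) *
      theta p (q r (c t) * q r 2 ^ d) / orderDen r p (q r 2 ^ d) := by
  rw [orderFactor, if_neg (lt_irrefl t), orderNum, if_pos rfl]

/-- From `a b Q = 1`, the argument `Q^(-s) a` is the inverse of `b Q^(s+1)`, and `Q^(-s-1) a` is the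
inverse of `a⁻¹ Q^(s+1)`. Reflection of theta therefore cancels the old numerator against the
denominator and creates the new one. -/
theorem theta_telescope {p a b Q : ℂ} (hp : ‖p‖ < 1) (h : a * b * Q = 1) (s : ℕ)
    (h1 : theta p (Q * Q ^ s) ≠ 0) (h2 : theta p (a * Q ^ (s + 1)) ≠ 0)
    (h3 : theta p (b * Q ^ (s + 1)) ≠ 0) :
    Q ^ s * theta p ((Q ^ s)⁻¹ * a) / theta p (Q * Q ^ s) *
      (theta p (Q ^ (s + 1)) * theta p (a⁻¹ * Q ^ (s + 1)) * theta p (a * Q ^ (s + 1)) /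
        (theta p (a * Q ^ (s + 1)) * theta p (b * Q ^ (s + 1)) * theta p (Q * Q ^ (s + 1)))) =
      Q ^ (s + 1) * theta p ((Q ^ (s + 1))⁻¹ * a) / theta p (Q * Q ^ (s + 1)) := by
  have ha : a ≠ 0 := by rintro rfl; simp at h
  have hb : b ≠ 0 := by rintro rfl; simp at h
  have hQ : Q ≠ 0 := by rintro rfl; simp at h
  have e0 : Q * Q ^ s = Q ^ (s + 1) := (pow_succ' Q s).symm
  have e1 : (Q ^ s)⁻¹ * a = (b * Q ^ (s + 1))⁻¹ := by
    rw [pow_succ]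
    field_simp
    linear_combination h
  have e2 : (Q ^ (s + 1))⁻¹ * a = (a⁻¹ * Q ^ (s + 1))⁻¹ := by
    field_simp
  have e3 : Q ^ s = a * b * Q ^ (s + 1) := by
    rw [pow_succ]
    linear_combination -(Q ^ s) * h
  have hx : Q ^ (s + 1) ≠ 0 := pow_ne_zero _ hQ
  rw [e0] at h1
  rw [e0, e1, e2, theta_inv hp (mul_ne_zero hb hx), theta_inv hp (mul_ne_zero (inv_ne_zero ha) hx),
    e3]
  field_simp

/-- Telescoping takes `a = q_{c_t}` and needs `b` to be the remaining one of `q₁, q₂`. For `c_t = 3`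
(index `2`) the left side vanishes for all `s ≥ 1`, whereas the theta factor on the right is only
forced to vanish at `s = 1`; hence the last hypothesis. -/
theorem blockStep_eq {r : Fin 3 → ℂ} (hq : q r 0 * q r 1 * q r 2 = 1) {p : ℂ} (hp : ‖p‖ < 1)
    {m : ℕ} (hpole : ∀ i : Fin 3, ∀ k < m, theta p (q r i * q r 2 ^ k) ≠ 0)
    {n : ℕ} (c : Fin n → Fin 3) (t : Fin n) (s : ℕ) (hs : s < m) (h : c t ≠ 2 ∨ s = 0) :
    blockStep r p c t s = qh r 2 ^ (2 * s + 1) * (qh r (c t))⁻¹ *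
      (theta p ((q r 2 ^ s)⁻¹ * q r (c t)) / theta p (q r 2 * q r 2 ^ s)) := by
  have hsq : q r 2 = qh r 2 ^ 2 := by rw [q, qh]; ring
  suffices H : theta p (q r (c t)) / theta p (q r 2) *
      ∏ a ∈ Finset.range s, orderFactor r p c t t (1 + a) =
      q r 2 ^ s * theta p ((q r 2 ^ s)⁻¹ * q r (c t)) / theta p (q r 2 * q r 2 ^ s) by
    rw [blockStep, vertexCoef, mul_assoc, H, pow_succ, pow_mul, ← hsq]
    ring
  rcases h with h | rfl
  · induction s with
    | zero => simp
    | succ s ih =>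
      rw [Finset.prod_range_succ, ← mul_assoc, ih (by omega), orderFactor_self, add_comm 1 s, orderDen]
      have h0 := hpole 0 (s + 1) hs
      have h1 := hpole 1 (s + 1) hs
      have h2 := hpole 2 s (by omega)
      generalize hi : c t = i at h
      fin_cases i
      · exact theta_telescope hp hq s h2 h0 h1
      · simp only [Fin.mk_one]
        rw [mul_comm (theta p (q r 0 * _)) (theta p (q r 1 * _))]
        exact theta_telescope hp (by rw [mul_comm (q r 1), hq]) s h2 h1 h0
      · exact absurd rfl h
  · simp

theorem thetaPoch_reflect (r : Fin 3 → ℂ) (hq : q r 0 * q r 1 * q r 2 = 1) (p a : ℂ) (k : ℕ) :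
    thetaPoch (q r 2 ^ (1 - (k : ℤ)) * a) (q r 2) p k =
      ∏ s ∈ Finset.range k, theta p ((q r 2 ^ s)⁻¹ * a) := by
  rw [thetaPoch, ← Finset.prod_range_reflect]
  refine Finset.prod_congr rfl fun s hs => ?_
  have hs := Finset.mem_range.1 hs
  rw [← mul_assoc, ← zpow_natCast, ← zpow_add₀ (q_ne_zero hq 2), ← zpow_natCast, ← zpow_neg]
  congr 3
  omega

theorem prod_odd_pow (a : ℂ) (k : ℕ) : ∏ s ∈ Finset.range k, a ^ (2 * s + 1) = a ^ (k ^ 2) := by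
  induction k with
  | zero => simp
  | succ k ih =>
    rw [Finset.prod_range_succ, ih, ← pow_add]
    congr 1
    ring

theorem prod_blockStep {r : Fin 3 → ℂ} (hq : q r 0 * q r 1 * q r 2 = 1) {p : ℂ} (hp : ‖p‖ < 1)
    {m : ℕ} (hpole : ∀ i : Fin 3, ∀ k < m, theta p (q r i * q r 2 ^ k) ≠ 0)
    {n : ℕ} (c : Fin n → Fin 3) (t : Fin n) (l : ℕ) (hl : l ≤ m) :
    ∏ s ∈ Finset.range l, blockStep r p c t s =
      qh r 2 ^ (l ^ 2) * (qh r (c t) ^ l)⁻¹ *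
      (thetaPoch (q r 2 ^ (1 - (l : ℤ)) * q r (c t)) (q r 2) p l /
        thetaPoch (q r 2) (q r 2) p l) := by
  have H : ∏ s ∈ Finset.range l, blockStep r p c t s =
      ∏ s ∈ Finset.range l, (qh r 2 ^ (2 * s + 1) * (qh r (c t))⁻¹ *
      (theta p ((q r 2 ^ s)⁻¹ * q r (c t)) / theta p (q r 2 * q r 2 ^ s))) := by
    -- Factors need not agree one by one in this case, but both products contain the zero factor `s
    -- = 1`: a site of type `3` occurs at most once in a block.
    by_cases h : c t = 2 ∧ 2 ≤ l
    · obtain ⟨h, h2⟩ := h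
      have h1 : theta p ((q r 2)⁻¹ * q r 2) = 0 := by
        rw [inv_mul_cancel₀ (q_ne_zero hq 2), theta_one hp]
      rw [Finset.prod_eq_zero (Finset.mem_range.2 (show 1 < l by omega)),
        Finset.prod_eq_zero (Finset.mem_range.2 (show 1 < l by omega))]
      · simp [h, h1]
      · simp [blockStep, orderFactor_self, h, h1]
    · refine Finset.prod_congr rfl fun s hs => ?_
      have hs := Finset.mem_range.1 hs
      refine blockStep_eq hq hp hpole c t s (by omega) ?_
      by_cases h2 : c t = 2
      · right
        have : ¬ 2 ≤ l := fun h3 => h ⟨h2, h3⟩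
        omega
      · exact Or.inl h2
  rw [H, Finset.prod_mul_distrib, Finset.prod_mul_distrib, prod_odd_pow, Finset.prod_const,
    Finset.card_range, inv_pow, Finset.prod_div_distrib, thetaPoch_reflect r hq]
  simp only [thetaPoch, mul_comm (q r 2)]

theorem listTerm_replicate_eq {r : Fin 3 → ℂ} (hq : q r 0 * q r 1 * q r 2 = 1) {p : ℂ}
    (hp : ‖p‖ < 1) {m : ℕ} (hpole : ∀ i : Fin 3, ∀ k < m, theta p (q r i * q r 2 ^ k) ≠ 0)
    {n : ℕ} (c : Fin n → Fin 3) (u : Fin n → ℂ) (z : ℂ) (t : Fin n) (l : ℕ) (hl : l ≤ m) :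
    listTerm r p c u z (List.replicate l t) = (-1) ^ l * miuraFactor r p c u t l z := by
  rw [listTerm_replicate, prod_blockStep hq hp hpole c t l hl, miuraFactor]
  rcases neg_one_pow_eq_or ℂ l with h | h
  · have h' : (-1 : Normal n) ^ l = 1 := by
      rcases Nat.even_or_odd l with e | e
      · exact e.neg_one_pow
      · rw [e.neg_one_pow] at h; norm_num at h
    rw [h, h', one_mul, one_mul]
  · have h' : (-1 : Normal n) ^ l = -1 := by
      rcases Nat.even_or_odd l with e | e
      · rw [e.neg_one_pow] at h; norm_num at h
      · exact e.neg_one_pow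
    rw [h, h']
    simp only [neg_mul, one_mul, neg_smul, neg_neg]

/-- The normally ordered product of the first `k` Miura factors. -/
def miuraPrefix (r : Fin 3 → ℂ) (p : ℂ) {n : ℕ} (c : Fin n → Fin 3) (u : Fin n → ℂ) (k : ℕ) :
    DiffOp n :=
  ((List.ofFn fun i => miuraFactor r p c u i).take k).foldl (DiffOp.mul r) (DiffOp.one n)

theorem miuraPrefix_succ (r : Fin 3 → ℂ) (p : ℂ) {n : ℕ} (c : Fin n → Fin 3) (u : Fin n → ℂ) {k : ℕ}
    (hk : k < n) : miuraPrefix r p c u (k + 1) =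
      DiffOp.mul r (miuraPrefix r p c u k) (miuraFactor r p c u ⟨k, hk⟩) := by
  rw [miuraPrefix, List.take_add_one, List.foldl_append, miuraPrefix]
  simp [hk]

/-- Adjoining the site `t = k`, larger than all previous ones, splits each surviving word into a
leading block of `t` and a word in the smaller letters. This is the convolution that defines
`DiffOp.mul`. -/
theorem sumLists_listTerm {r : Fin 3 → ℂ} (hq : q r 0 * q r 1 * q r 2 = 1) {p : ℂ}
    (hp : ‖p‖ < 1) {m : ℕ} (hpole : ∀ i : Fin 3, ∀ k < m, theta p (q r i * q r 2 ^ k) ≠ 0)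
    {n : ℕ} (c : Fin n → Fin 3) (u : Fin n → ℂ) (z : ℂ) (k : ℕ) (hk : k ≤ n) :
    ∀ j ≤ m, sumLists (Finset.univ.filter fun i : Fin n => (i : ℕ) < k) j (listTerm r p c u z) =
      (-1) ^ j * miuraPrefix r p c u k j z := by
  induction k with
  | zero =>
    intro j _
    cases j with
    | zero => simp [sumLists, listTerm, miuraPrefix, DiffOp.one]
    | succ j => simp [sumLists, miuraPrefix, DiffOp.one]
  | succ k ih =>
    intro j hj
    set S := Finset.univ.filter fun i : Fin n => (i : ℕ) < k
    set t : Fin n := ⟨k, hk⟩ with ht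
    have hS : ∀ i ∈ S, i < t := fun i hi => by simpa [S, t, Fin.lt_def] using hi
    have hins : (Finset.univ.filter fun i : Fin n => (i : ℕ) < k + 1) = insert t S := by
      ext i
      simp [S, t, Fin.ext_iff]
      omega
    have h := sumLists_listTerm_insert hq hp c u z hS j 0
    simp only [List.replicate_zero, List.nil_append, zero_add] at h
    -- The swap is needed because the word has the new block first, while the Miura product has the
    -- new factor last.
    rw [hins, h, miuraPrefix_succ r p c u hk, DiffOp.mul, Finset.mul_sum,
      ← Finset.Nat.sum_antidiagonal_swap]
    refine Finset.sum_congr rfl fun x hx => ?_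
    have hx := Finset.HasAntidiagonal.mem_antidiagonal.1 hx
    simp only [Prod.fst_swap, Prod.snd_swap]
    rw [sumLists_congr (ψ := fun L => (-1) ^ x.2 * miuraFactor r p c u t x.2
      ((q r 2 ^ x.1)⁻¹ * z) * listTerm r p c u z L), sumLists_mul_left, ih (by omega) x.1 (by omega),
      ← hx, pow_add]
    · ring
    · intro L hL hLS
      rw [listTerm_replicate_append _ _ _ _ _ _ _ _ fun i hi => hS i (hLS i hi),
        listTerm_replicate_eq hq hp hpole c u _ t x.2 (by omega), hL]

theorem currentT_eq_sum {r : Fin 3 → ℂ} (hq : q r 0 * q r 1 * q r 2 = 1) {p : ℂ}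
    (hp : ‖p‖ < 1) {m : ℕ} (hpole : ∀ i : Fin 3, ∀ k < m, theta p (q r i * q r 2 ^ k) ≠ 0)
    {n : ℕ} (c : Fin n → Fin 3) (u : Fin n → ℂ) (z : ℂ) :
    currentT r p c u m z = ∑ J : Fin m → Fin n, listTerm r p c u z (List.ofFn J) := by
  have h := sumLists_listTerm hq hp hpole c u z n le_rfl m le_rfl
  have h1 : (Finset.univ.filter fun i : Fin n => (i : ℕ) < n) = Finset.univ := by simp
  have h2 : miuraPrefix r p c u n = miura r p c u := by
    rw [miuraPrefix, List.take_of_length_le (by simp)]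
    rfl
  rw [h1, sumLists_univ, h2] at h
  exact h.symm

/-- The rescaling of `u` is chosen so that this coefficient is the initial value of the telescoping
product, namely the `s = 0` case of `blockStep`. -/
theorem uPrime_mul_dTilde₁ (r : Fin 3 → ℂ) {n : ℕ} (c : Fin n → Fin 3) (u : Fin n → ℂ) {p : ℂ}
    (hp : ‖p‖ < 1) (hQ : thetaProd r p ≠ 0) (j : Fin n) :
    uPrime r p c u j * dTilde₁ r p (c j) = vertexCoef r p (c j) * u j := by
  refine mul_left_cancel₀ (pow_ne_zero 2 hQ) ?_
  rw [thetaProd_sq_mul r c u hp, coefNum, vertexCoef]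
  have h2 : theta p (q r 2) ≠ 0 := right_ne_zero_of_mul hQ
  rw [thetaProd]
  field_simp

theorem pairProd_congr {m : ℕ} {f g : Fin m → Fin m → ℂ} (h : ∀ a b, a < b → f a b = g a b) :
    pairProd f = pairProd g :=
  Finset.prod_congr rfl fun a _ => Finset.prod_congr rfl fun b _ => by
    split_ifs with hab
    · exact h a b hab
    · rfl

theorem toOp_listTerm (r : Fin 3 → ℂ) (p : ℂ) {n m : ℕ} (c : Fin n → Fin 3) (u : Fin n → ℂ) (z : ℂ)
    (J : Fin m → Fin n) (β α : Fin n → State) :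
    toOp r p c (listTerm r p c u z (List.ofFn J)) β α =
      (∏ a, vertexCoef r p (c (J a)) * u (J a)) *
        ((pairProd fun a b => orderFactor r p c (J a) (J b) ((b : ℕ) - (a : ℕ))) *
        orderedEntry r c β α J (p, fun a : Fin m => q r 2 ^ (-(m : ℤ) + 1 + (a : ℕ)) * z)) := by
  rw [listTerm_ofFn, prod_vertexOp, AddMonoidAlgebra.smul_single, toOp_single, annExp_sum,
    Finset.prod_mul_distrib, orderedEntry, smul_eq_mul]
  have h : (fun k => ((∑ a : Fin m, vertexExp r p c (J a)
      (q r 2 ^ (-(m : ℤ) + 1 + (a : ℕ)) * z)) k).1) = ∑ a : Fin m, fun k =>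
      (vertexExp r p c (J a) (q r 2 ^ (-(m : ℤ) + 1 + (a : ℕ)) * z) k).1 := by
    funext k
    simp only [Finset.sum_apply, Prod.fst_sum]
  rw [h]
  ring

end EllCorner

end

/-! ### Evaluation at the geometric progression of arguments. -/

theorem mainTheorem5
    (r : Fin 3 → ℂ)
    (hq : EllCorner.q r 0 * EllCorner.q r 1 * EllCorner.q r 2 = 1)
    (hgen : ∀ L M N : ℤ,
      EllCorner.q r 0 ^ L * EllCorner.q r 1 ^ M * EllCorner.q r 2 ^ N = 1 → L = M ∧ M = N)
    (p : ℂ) (hp0 : p ≠ 0) (hp1 : ‖p‖ < 1)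
    (n : ℕ) (c : Fin n → Fin 3) (u : Fin n → ℂ)
    (m : ℕ) (hm : 1 ≤ m)
    (hpole : ∀ i : Fin 3, ∀ k < m, EllCorner.theta p (EllCorner.q r i * EllCorner.q r 2 ^ k) ≠ 0)
    (z : ℂ) (hz : z ≠ 0) (β α : Fin n → EllCorner.State) :
    EllCorner.HasContinuedProductEntry
      (fun p' w => (EllCorner.tensorRep r p' n c (EllCorner.uPrime r p' c u)).E w)
      p (fun a : Fin m => EllCorner.q r 2 ^ (-(m : ℤ) + 1 + (a : ℕ)) * z) β α
      (EllCorner.toOp r p c (EllCorner.currentT r p c u m z) β α) := by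
  have hQ0 := EllCorner.q_ne_zero hq 2
  set x : ℂ × (Fin m → ℂ) :=
    (p, fun a : Fin m => EllCorner.q r 2 ^ (-(m : ℤ) + 1 + (a : ℕ)) * z) with hx
  have hratio : ∀ a b : Fin m, a < b →
      x.2 b / x.2 a = EllCorner.q r 2 ^ ((b : ℕ) - (a : ℕ)) := by
    intro a b hab
    have hab' : (a : ℕ) ≤ b := hab.le
    rw [div_eq_iff (mul_ne_zero (zpow_ne_zero _ hQ0) hz)]
    change EllCorner.q r 2 ^ (-(m : ℤ) + 1 + (b : ℕ)) * z =
      _ * (EllCorner.q r 2 ^ (-(m : ℤ) + 1 + (a : ℕ)) * z)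
    rw [← mul_assoc, ← zpow_natCast, ← zpow_add₀ hQ0]
    congr 2
    push_cast [hab']
    ring
  -- The differences `b - a` are below `m`, so the hypothesis covers exactly the denominators that
  -- occur.
  have hden : ∀ a b : Fin m, a < b →
      EllCorner.orderDen r p (EllCorner.q r 2 ^ ((b : ℕ) - (a : ℕ))) ≠ 0 := fun a b _ =>
    mul_ne_zero (mul_ne_zero (hpole 0 _ (by omega)) (hpole 1 _ (by omega))) (hpole 2 _ (by omega))
  have hthetaProd : EllCorner.thetaProd r p ≠ 0 := by
    have h := fun i => hpole i 0 (by omega)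
    simp only [pow_zero, mul_one] at h
    exact mul_ne_zero (mul_ne_zero (h 0) (h 1)) (h 2)
  have hdom : x ∈ EllCorner.domain m :=
    ⟨hp0, hp1, fun a => mul_ne_zero (zpow_ne_zero _ hQ0) hz⟩
  have key := EllCorner.hasContinuedProductEntry_tensorRep hq hgen c u β α hdom hthetaProd
    fun a b hab => by rw [hratio a b hab]; exact hden a b hab
  convert key using 1
  rw [EllCorner.currentT_eq_sum hq hp1 hpole, EllCorner.toOp_sum]
  refine Finset.sum_congr rfl fun J _ => ?_
  rw [EllCorner.toOp_listTerm]
  congr 1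
  · exact Finset.prod_congr rfl fun a _ =>
      (EllCorner.uPrime_mul_dTilde₁ r c u hp1 hthetaProd (J a)).symm
  · congr 1
    refine EllCorner.pairProd_congr fun a b hab => ?_
    rw [hratio a b hab, EllCorner.orderFactor]
    -- For decreasing sites `orderFactor` is `1` by definition, while the product formula has a
    -- quotient of equal terms; nonvanishing of the denominator reconciles them.
    split_ifs with h
    · rw [EllCorner.orderNum, if_neg h.ne', if_neg h.not_gt]
      exact (div_self (hden a b hab)).symm
    · rfl
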